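/- **Setting.** Let $d\ge 1$ and let $(H_s)_{s\in\mathbb Z^d}$ be a stationary $0/1$-valued random field ($H_s=0$ means that the null hypothesis at $s$ is true), $\pi_0=\mathbb P(H_s=0)$, $\pi_1=1-\pi_0$. For $n_1,\dots,n_d\in\mathbb N$ let $C=\{1,\dots,n_1\}\times\dots\times\{1,\dots,n_d\}$, $n=n_1\cdots n_d$ and $N_C=\sum_{s\in C}H_s$. All asymptotics are as $\min_{k\le d} n_k\to\infty$. *Condition 1:* $\{\mathbb E(N_C-n\pi_1)^2\}^{1/2}=O(\sqrt n)$, and $n^{-1/2}(N_C-n\pi_1)\Rightarrow N(0,\sigma^2)$ for some $0\le\sigma^2<\infty$. Let $G$ be a distribution function on $[0,1]$ (so $G(0)=0$, $G(1)=1$) that is differentiable on $[0,1]$ (one-sidedly at the endpoints) with bounded derivative $g=G'$, and let $G^{-1}(u)=\inf\{x\in[0,1]:G(x)\ge u\}$. The p-values are $$X_s=(1-H_s)U_s+H_sG^{-1}(U_s),$$ where the $U_s$ are i.i.d. uniform$(0,1)$ and independent of the field $(H_s)$. Put $F(t)=\pi_0t+\pi_1G(t)$, $f(t)=F'(t)=\pi_0+\pi_1g(t)$,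 $\alpha_*=1/f(0)$, $$F_n(t)=\frac1n\sum_{s\in C}\mathbf 1_{X_s\le t},\quad \Lambda_n(t)=\frac1n\sum_{s\in C}(1-H_s)\mathbf 1_{X_s\le t},\quad \Gamma_n(t)=\frac{n\Lambda_n(t)}{nF_n(t)+\prod_{s\in C}\mathbf 1_{X_s>t}} .$$ For a bandwidth $b_n\in(0,1)$ let $\hat\pi_0=\{1-F_n(1-b_n)\}/b_n$ (Storey's estimator), and for a level $\alpha>0$ let $$\nu_{\rm PI}=\sup\{t\in[0,1]:t\hat\pi_0/\alpha\le F_n(t)\},\qquad \nu_*=\sup\{t\in[0,1]:t\pi_0/\alpha\le F(t)\}.$$ **Theorem.** Assume Condition 1, $g(1)=0$, $b_n\asymp n^{-1/3}$, $\alpha_*<\alpha/\pi_0<1$ (equivalently, given $\alpha_*<\alpha/\pi_0$, that $\nu_*<1$) and $\pi_0/\alpha>f(\nu_*)$. Assume also that $f(t)-f(a)=O(|t-a|)$ as $t\to a$, $t\in[0,1]$, for $a=\nu_*$ and for $a=1$ (for example, that $f$ is differentiable at $\nu_*$ and at $1$). Then (i) $$\nu_{\rm PI}-\nu_*=\frac{\nu_*(\pi_0-\hat\pi_0)}{\pi_0-\alpha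 f(\nu_*)}+\frac{F_n(\nu_*)-F(\nu_*)}{\pi_0/\alpha-f(\nu_*)}+O_{\mathbb P}(n^{-2/3});$$ (ii) $$\Gamma_n(\nu_{\rm PI})-\alpha=\alpha\,(1-\hat\pi_0/\pi_0)+O_{\mathbb P}(n^{-1/2}).$$ -/

import Mathlib

open MeasureTheory ProbabilityTheory Filter Topology Asymptotics

noncomputable section

namespace FDR

/-- `Y i = O_P(r i)` along the filter `l`: for every `ε > 0` there is a constant `M` such that,
eventually along `l`, the probability of `|Y i| > M * r i` is at most `ε`. -/
def IsBigOP {Ω ι : Type*} [MeasurableSpace Ω] (μ : Measure Ω) (l : Filter ι)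
    (Y : ι → Ω → ℝ) (r : ι → ℝ) : Prop :=
  ∀ ε : ℝ, 0 < ε → ∃ M : ℝ, ∀ᶠ i in l, μ.real {ω | M * r i < |Y i ω|} ≤ ε

section Field

variable {d : ℕ}

/-- The cube `{1, …, N 1} × ⋯ × {1, …, N d}` in `ℤ ^ d`. -/
def cube (N : Fin d → ℕ) : Finset (Fin d → ℤ) :=
  Fintype.piFinset fun k => Finset.Icc (1 : ℤ) (N k)

/-- The number `n = N 1 * ⋯ * N d` of sites of the cube. -/
def cubeSize (N : Fin d → ℕ) : ℕ := ∏ k, N k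

variable {Ω : Type*} [MeasurableSpace Ω]

/-- `π₀ = P(H_s = 0)`; for a stationary field it does not depend on `s`, here `s = 0`. -/
def nullProp (μ : Measure Ω) (H : (Fin d → ℤ) → Ω → ℝ) : ℝ := μ.real {ω | H 0 ω = 0}

/-- The number of false null hypotheses in the cube. -/
def falseNulls (H : (Fin d → ℤ) → Ω → ℝ) (N : Fin d → ℕ) (ω : Ω) : ℝ := ∑ s ∈ cube N, H s ω

/-- A stationary `0/1`-valued random field on `ℤ ^ d` whose sums over cubes have fluctuations of
order `√n` in `L²` and satisfy the central limit theorem with some finite limit variance (possibly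
zero). The filter `atTop` on `Fin d → ℕ` (with the product order) is `min_k N k → ∞`. -/
structure Condition1 (μ : Measure Ω) [IsProbabilityMeasure μ]
    (H : (Fin d → ℤ) → Ω → ℝ) : Prop where
  measurable : ∀ s, Measurable (H s)
  zero_or_one : ∀ s ω, H s ω = 0 ∨ H s ω = 1
  stationary : ∀ v : Fin d → ℤ,
    μ.map (fun ω s => H (s + v) ω) = μ.map (fun ω s => H s ω)
  l2_bound :
    (fun N : Fin d → ℕ =>
      √(∫ ω, (falseNulls H N ω - cubeSize N * (1 - nullProp μ H)) ^ 2 ∂μ))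
      =O[atTop] fun N => √(cubeSize N : ℝ)
  clt : ∃ v : NNReal,
    TendstoInDistribution
      (fun (N : Fin d → ℕ) ω =>
        (falseNulls H N ω - cubeSize N * (1 - nullProp μ H)) / √(cubeSize N : ℝ))
      atTop (id : ℝ → ℝ) (fun _ => μ) (gaussianReal 0 v)

/-- `(U_s)` are i.i.d. uniform on `(0, 1)` and independent of the field `(H_s)`. -/
structure IsUniformNoise (μ : Measure Ω) (H U : (Fin d → ℤ) → Ω → ℝ) : Prop where
  measurable : ∀ s, Measurable (U s)
  uniform : ∀ s, μ.map (U s) = volume.restrict (Set.Ioo (0 : ℝ) 1)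
  iIndep : iIndepFun U μ
  indep_field : IndepFun (fun ω s => U s ω) (fun ω s => H s ω) μ

/-- `Λ_n(t) = n⁻¹ ∑ (1 - H_s) 1{X_s ≤ t}`, the sum being over the cube. -/
def empNull (H X : (Fin d → ℤ) → Ω → ℝ) (N : Fin d → ℕ) (ω : Ω) (t : ℝ) : ℝ :=
  (∑ s ∈ cube N, (1 - H s ω) * (if X s ω ≤ t then 1 else 0)) / cubeSize N

/-- `F_n(t) = n⁻¹ ∑ 1{X_s ≤ t}`, the empirical distribution function of the p-values. -/
def empCdf (X : (Fin d → ℤ) → Ω → ℝ) (N : Fin d → ℕ) (ω : Ω) (t : ℝ) : ℝ :=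
  (∑ s ∈ cube N, (if X s ω ≤ t then 1 else 0)) / cubeSize N

/-- The false discovery process `Γ_n(t) = n Λ_n(t) / (n F_n(t) + ∏ 1{X_s > t})`. -/
def fdProcess (H X : (Fin d → ℤ) → Ω → ℝ) (N : Fin d → ℕ) (ω : Ω) (t : ℝ) : ℝ :=
  (cubeSize N * empNull H X N ω t) /
    (cubeSize N * empCdf X N ω t + ∏ s ∈ cube N, (if t < X s ω then 1 else 0))

/-- Storey's estimator `(1 - F_n(1 - b)) / b` of `π₀`. -/
def storey (X : (Fin d → ℤ) → Ω → ℝ) (b : ℝ) (N : Fin d → ℕ) (ω : Ω) : ℝ :=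
  (1 - empCdf X N ω (1 - b)) / b

end Field

/-- `G` is (on `[0, 1]`) a distribution function with bounded density `g = G'`. -/
structure IsAltCdf (G g : ℝ → ℝ) : Prop where
  mono : MonotoneOn G (Set.Icc 0 1)
  zero : G 0 = 0
  one : G 1 = 1
  deriv : ∀ x ∈ Set.Icc (0 : ℝ) 1, HasDerivWithinAt G (g x) (Set.Icc 0 1) x
  bounded : ∃ K : ℝ, ∀ x ∈ Set.Icc (0 : ℝ) 1, g x ≤ K

/-- `G⁻¹(u) = inf {x ∈ [0, 1] : G x ≥ u}`. -/
def quantile (G : ℝ → ℝ) (u : ℝ) : ℝ := sInf {x ∈ Set.Icc (0 : ℝ) 1 | u ≤ G x}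

/-- The marginal distribution function `F(t) = π₀ t + π₁ G(t)` of a p-value. -/
def mixCdf (p₀ : ℝ) (G : ℝ → ℝ) (t : ℝ) : ℝ := p₀ * t + (1 - p₀) * G t

/-- The marginal density `f(t) = π₀ + π₁ g(t)` of a p-value. -/
def mixDens (p₀ : ℝ) (g : ℝ → ℝ) (t : ℝ) : ℝ := p₀ + (1 - p₀) * g t

/-- `sup {t ∈ [0, 1] : t p / α ≤ Φ(t)}`: this is `ν_*` for `p = π₀`, `Φ = F`, and the plug-in
threshold for `p` the estimator of `π₀` and `Φ = F_n`. -/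
def threshold (α p : ℝ) (Φ : ℝ → ℝ) : ℝ := sSup {t ∈ Set.Icc (0 : ℝ) 1 | t * p / α ≤ Φ t}

/-- The critical level `α_* = 1 / f(0)`. -/
def alphaStar (p₀ : ℝ) (g : ℝ → ℝ) : ℝ := 1 / mixDens p₀ g 0

end FDR

end

/-! Put `n = cubeSize N`, let `e` be the proportion of false nulls minus `π₁`, and let `D =
centredCdf` be the empirical process centred given the field `H`. The exact identity `F_n(t) = F(t)
+ D(t) + e * (G t - t)` (`empCdf_eq_mixCdf_add`) separates the noise of `U` from that of `H`.
Chebyshev's inequality gives `e = O_P(n^(-1/2))`. Given `H`, `D` is an average of independent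
centred indicators, so chaining with fourth moments shows that it oscillates by `O_P(√(n ℓ) / n)` on
a window of length `ℓ` (`exists_oscillation_bound`). The constant there does not depend on the
thresholds of the indicators, so it survives averaging over `H`
(`measureReal_mem_random_finset_le`).

On windows of length of order `n^(-1/3)` the oscillation is `O_P(n^(-2/3))`. Near `1`, where `D`
vanishes and `f 1 = π₀`, this yields `πhat - π₀ = O_P(n^(-1/3))`. Since `F` leaves the line of slope
`π₀ / α` at least linearly at its last crossing `νs` (`exists_linear_gap`), also `νPI - νs =
O_P(n^(-1/3))`. Subtracting the two crossing equations `F_n(νPI) = νPI * πhat / α` and `F(νs) = νs *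
π₀ / α` then gives (i): what remains is the oscillation of `D` plus products of two terms of order
at most `n^(-1/3)`. For (ii), the crossing equation evaluates the denominator of the false discovery
process, and its numerator is `π₀ * νPI + O_P(n^(-1/2))`. -/

namespace FDR

/-! ### Moments of sums of independent bounded variables. -/

section Moments

variable {Ω ι : Type*} [MeasurableSpace Ω] {μ : Measure Ω}

lemma integral_pow_mul_pow_of_indepFun {S Y : Ω → ℝ} (hS : Measurable S) (hY : Measurable Y)
    (h : IndepFun S Y μ) (a b : ℕ) :
    ∫ ω, S ω ^ a * Y ω ^ b ∂μ = (∫ ω, S ω ^ a ∂μ) * ∫ ω, Y ω ^ b ∂μ := by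
  have h' : IndepFun (fun ω => S ω ^ a) (fun ω => Y ω ^ b) μ :=
    h.comp (φ := fun x : ℝ => x ^ a) (ψ := fun x : ℝ => x ^ b) (by fun_prop) (by fun_prop)
  exact h'.integral_fun_mul_eq_mul_integral (hS.pow_const a).aestronglyMeasurable
    (hY.pow_const b).aestronglyMeasurable

variable [IsProbabilityMeasure μ]

lemma integrable_pow_mul_pow_of_bounded {S Y : Ω → ℝ} (hS : Measurable S) (hY : Measurable Y)
    {c e : ℝ} (hc : ∀ ω, |S ω| ≤ c) (he : ∀ ω, |Y ω| ≤ e) (a b : ℕ) :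
    Integrable (fun ω => S ω ^ a * Y ω ^ b) μ := by
  refine Integrable.of_bound ((hS.pow_const a).mul (hY.pow_const b)).aestronglyMeasurable
    (c ^ a * e ^ b) (ae_of_all _ fun ω => ?_)
  rw [Real.norm_eq_abs, abs_mul, abs_pow, abs_pow]
  have h1 := hc ω
  have h2 := he ω
  have := (abs_nonneg _).trans h1
  gcongr

/-- The first, second and fourth moments of a sum of independent centred variables that are bounded
by `1` and have variance at most `p`. -/
lemma moments_sum_of_iIndepFun {f : ι → Ω → ℝ} (hf : iIndepFun f μ) (hm : ∀ i, Measurable (f i))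
    (h1 : ∀ i ω, |f i ω| ≤ 1) (h0 : ∀ i, ∫ ω, f i ω ∂μ = 0) {p : ℝ}
    (h2 : ∀ i, ∫ ω, f i ω ^ 2 ∂μ ≤ p) (A : Finset ι) :
    ∫ ω, ∑ i ∈ A, f i ω ∂μ = 0 ∧ ∫ ω, (∑ i ∈ A, f i ω) ^ 2 ∂μ ≤ A.card * p ∧
      ∫ ω, (∑ i ∈ A, f i ω) ^ 4 ∂μ ≤ 3 * (A.card * p) ^ 2 + A.card * p := by
  classical
  induction A using Finset.induction_on with
  | empty => simp
  | insert i A hi ih =>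
    obtain ⟨e1, e2, e4⟩ := ih
    set S : Ω → ℝ := fun ω => ∑ j ∈ A, f j ω with hSdef
    have hSm : Measurable S := Finset.measurable_sum _ fun j _ => hm j
    have hSb : ∀ ω, |S ω| ≤ A.card := fun ω => by
      refine (Finset.abs_sum_le_sum_abs _ _).trans ?_
      simpa using Finset.sum_le_sum fun j (_ : j ∈ A) => h1 j ω
    have hind : IndepFun S (f i) μ := by
      have := hf.indepFun_finsetSum_of_notMem hm hi
      convert this using 1
      ext ω; simp [hSdef]
    have hI := integrable_pow_mul_pow_of_bounded (μ := μ) hSm (hm i) hSb (h1 i)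
    have hE := integral_pow_mul_pow_of_indepFun hSm (hm i) hind
    have hp : 0 ≤ p := (integral_nonneg fun ω => sq_nonneg (f i ω)).trans (h2 i)
    have hf4 : ∫ ω, f i ω ^ 4 ∂μ ≤ p := by
      -- As `|f i| ≤ 1`, the fourth moment is at most the second.
      refine (integral_mono (by simpa using hI 0 4) (by simpa using hI 0 2) fun ω => ?_).trans (h2 i)
      have := (sq_le_one_iff_abs_le_one _).2 (h1 i ω)
      show f i ω ^ 4 ≤ f i ω ^ 2
      nlinarith [sq_nonneg (f i ω)]
    have hf2 : 0 ≤ ∫ ω, f i ω ^ 2 ∂μ := integral_nonneg fun ω => sq_nonneg _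
    simp only [Finset.sum_insert hi, Finset.card_insert_of_notMem hi]
    push_cast
    have i10 := hI 1 0
    have i01 := hI 0 1
    have i02 := hI 0 2
    have i20 := hI 2 0
    have i40 := hI 4 0
    have i04 := hI 0 4
    have s11 := hE 1 1
    have s31 := hE 3 1
    have s13 := hE 1 3
    have s22 := hE 2 2
    have i11 := hI 1 1
    have i31 := hI 3 1
    have i13 := hI 1 3
    have i22 := hI 2 2
    simp only [pow_zero, mul_one, one_mul, pow_one] at i10 i01 i02 i20 i40 i04 s11 s31 s13 i11 i31 i13
    change ∫ ω, S ω ∂μ = 0 at e1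
    change ∫ ω, S ω ^ 2 ∂μ ≤ A.card * p at e2
    change ∫ ω, S ω ^ 4 ∂μ ≤ 3 * (A.card * p) ^ 2 + A.card * p at e4
    rw [h0, mul_zero] at s11 s31
    rw [e1, zero_mul] at s13
    refine ⟨?_, ?_, ?_⟩
    · rw [integral_add i01 i10, h0, zero_add]; exact e1
    · have : ∀ ω, (f i ω + S ω) ^ 2 = f i ω ^ 2 + (S ω ^ 2 + 2 * (S ω * f i ω)) := fun ω => by ring
      change ∫ ω, (f i ω + S ω) ^ 2 ∂μ ≤ _
      simp only [this]
      have j0 : Integrable (fun ω => S ω ^ 2 + 2 * (S ω * f i ω)) μ := i20.add (i11.const_mul 2)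
      rw [integral_add i02 j0, integral_add i20 (i11.const_mul 2), integral_const_mul, s11]
      linarith [h2 i]
    · have : ∀ ω, (f i ω + S ω) ^ 4 = f i ω ^ 4 + (S ω ^ 4 + (4 * (S ω ^ 3 * f i ω) +
          (4 * (S ω * f i ω ^ 3) + 6 * (S ω ^ 2 * f i ω ^ 2)))) := fun ω => by ring
      change ∫ ω, (f i ω + S ω) ^ 4 ∂μ ≤ _
      simp only [this]
      have j1 : Integrable (fun ω => 4 * (S ω * f i ω ^ 3) + 6 * (S ω ^ 2 * f i ω ^ 2)) μ :=
        (i13.const_mul 4).add (i22.const_mul 6)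
      have j2 : Integrable (fun ω => 4 * (S ω ^ 3 * f i ω) +
          (4 * (S ω * f i ω ^ 3) + 6 * (S ω ^ 2 * f i ω ^ 2))) μ := (i31.const_mul 4).add j1
      have j3 : Integrable (fun ω => S ω ^ 4 + (4 * (S ω ^ 3 * f i ω) +
          (4 * (S ω * f i ω ^ 3) + 6 * (S ω ^ 2 * f i ω ^ 2)))) μ := i40.add j2
      rw [integral_add i04 j3, integral_add i40 j2, integral_add (i31.const_mul 4) j1,
        integral_add (i13.const_mul 4) (i22.const_mul 6)]
      simp only [integral_const_mul]
      rw [s31, s13, s22]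
      have hmul : (∫ ω, S ω ^ 2 ∂μ) * ∫ ω, f i ω ^ 2 ∂μ ≤ A.card * p * p :=
        mul_le_mul e2 (h2 i) hf2 (by positivity)
      nlinarith [sq_nonneg p]

/-- The centred indicator of `{a < V ≤ b}` for a uniform variable `V`. -/
lemma integral_centred_indicator {V : Ω → ℝ} (hV : Measurable V)
    (hu : μ.map V = volume.restrict (Set.Ioo (0 : ℝ) 1)) {a b : ℝ} (ha : 0 ≤ a) (hab : a ≤ b)
    (hb : b ≤ 1) :
    (∀ ω, |((if V ω ≤ b then (1 : ℝ) else 0) - b) - ((if V ω ≤ a then (1 : ℝ) else 0) - a)| ≤ 1) ∧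
    ∫ ω, (((if V ω ≤ b then (1 : ℝ) else 0) - b) - ((if V ω ≤ a then (1 : ℝ) else 0) - a)) ∂μ = 0 ∧
    ∫ ω, (((if V ω ≤ b then (1 : ℝ) else 0) - b) - ((if V ω ≤ a then (1 : ℝ) else 0) - a)) ^ 2 ∂μ
      ≤ b - a := by
  set D : Set Ω := V ⁻¹' Set.Ioc a b with hD
  have hDm : MeasurableSet D := hV measurableSet_Ioc
  have hDr : μ.real D = b - a := by
    rw [measureReal_def, ← Measure.map_apply hV measurableSet_Ioc, hu,
      Measure.restrict_apply measurableSet_Ioc, ← Measure.restrict_apply' measurableSet_Ioo,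
      Measure.restrict_congr_set Ioo_ae_eq_Ioc, Measure.restrict_apply measurableSet_Ioc,
      Set.Ioc_inter_Ioc, max_eq_left ha, min_eq_left hb, Real.volume_Ioc,
      ENNReal.toReal_ofReal (by linarith)]
  have key : ∀ ω, ((if V ω ≤ b then (1 : ℝ) else 0) - b) - ((if V ω ≤ a then (1 : ℝ) else 0) - a)
      = D.indicator (fun _ => (1 : ℝ)) ω - (b - a) := fun ω => by
    by_cases h1 : V ω ≤ a
    · have h2 : V ω ≤ b := h1.trans hab
      have : ω ∉ D := fun h => absurd h.1 (not_lt.2 h1)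
      simp [h1, h2, this]
    · by_cases h2 : V ω ≤ b
      · have : ω ∈ D := ⟨not_le.1 h1, h2⟩
        simp [h1, h2, this]; ring
      · have : ω ∉ D := fun h => absurd h.2 h2
        simp [h1, h2, this]; ring
  have hint : Integrable (D.indicator (fun _ => (1 : ℝ))) μ :=
    (integrable_const 1).indicator hDm
  have hval : ∫ ω, D.indicator (fun _ => (1 : ℝ)) ω ∂μ = b - a := by
    rw [integral_indicator_const _ hDm, hDr]; simp
  simp only [key]
  refine ⟨fun ω => ?_, ?_, ?_⟩
  · by_cases h : ω ∈ D <;> simp only [h, Set.indicator_of_mem, Set.indicator_of_notMem,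
      not_false_eq_true] <;> rw [abs_le] <;> constructor <;> linarith
  · rw [integral_sub hint (integrable_const _), hval]; simp
  · have : ∀ ω, (D.indicator (fun _ => (1 : ℝ)) ω - (b - a)) ^ 2
        = (1 - 2 * (b - a)) * D.indicator (fun _ => (1 : ℝ)) ω + (b - a) ^ 2 := fun ω => by
      by_cases h : ω ∈ D <;> simp [h] <;> ring
    simp only [this]
    rw [integral_add (hint.const_mul _) (integrable_const _), integral_const_mul, hval]
    simp
    nlinarith

end Moments

/-! ### Chaining bound for the oscillation of centred indicator sums. -/

section Oscillation

/-- Dyadic chaining for a finite sequence. -/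
lemma abs_sub_le_sum_of_dyadic (β : ℕ → ℝ) (hβ : ∀ j, 0 ≤ β j) (m : ℕ) (w : ℕ → ℝ)
    (h : ∀ j ≤ m, ∀ i < 2 ^ j, |w ((i + 1) * 2 ^ (m - j)) - w (i * 2 ^ (m - j))| ≤ β j) :
    ∀ i ≤ 2 ^ m, |w i - w 0| ≤ ∑ j ∈ Finset.range (m + 1), β j := by
  induction m generalizing w with
  | zero =>
    intro i hi
    have h0 := h 0 le_rfl 0 (by norm_num)
    simp only [pow_zero] at hi
    interval_cases i
    · simpa using hβ 0
    · simpa using h0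
  | succ m ih =>
    intro i hi
    -- The even points form a dyadic sequence one level coarser; an odd point is one finest step
    -- away from its even predecessor.
    have hw : ∀ i ≤ 2 ^ m, |w (2 * i) - w 0| ≤ ∑ j ∈ Finset.range (m + 1), β j := by
      refine ih (fun i => w (2 * i)) fun j hj i hij => ?_
      have := h j (by omega) i hij
      rw [show m + 1 - j = (m - j) + 1 by omega, pow_succ] at this
      convert this using 4 <;> ring
    rw [Finset.sum_range_succ]
    rw [pow_succ] at hi
    obtain ⟨q, hq | hq⟩ := Nat.even_or_odd' i
    · subst hq
      linarith [hw q (by omega), hβ (m + 1)]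
    · subst hq
      have h1 := hw q (by omega)
      have h2 := h (m + 1) le_rfl (2 * q) (by rw [pow_succ]; omega)
      simp only [Nat.sub_self, pow_zero, mul_one] at h2
      have := abs_sub_le (w (2 * q + 1)) (w (2 * q)) (w 0)
      linarith

/-- `φ` is on `[0, 1]` nondecreasing with values in `[0, 1]` and slopes at most `K`. -/
def IsSlowCdf (K : ℝ) (φ : ℝ → ℝ) : Prop :=
  ∀ x y, 0 ≤ x → x ≤ y → y ≤ 1 → 0 ≤ φ x ∧ φ x ≤ φ y ∧ φ y ≤ 1 ∧ φ y - φ x ≤ K * (y - x)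

variable {ι : Type*}

/-- The sum over `C` of the centred indicators of `{u s ≤ c s t}`. -/
noncomputable def centredSum (C : Finset ι) (c : ι → ℝ → ℝ) (t : ℝ) (u : ι → ℝ) : ℝ :=
  ∑ s ∈ C, ((if u s ≤ c s t then (1 : ℝ) else 0) - c s t)

lemma measurable_centredSum (C : Finset ι) (c : ι → ℝ → ℝ) (t : ℝ) :
    Measurable (centredSum C c t) := by
  refine Finset.measurable_sum _ fun s _ => Measurable.sub_const ?_ _
  exact Measurable.ite (measurableSet_le (measurable_pi_apply s) measurable_const)
    measurable_const measurable_const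

/-- The indicators only increase with `t`, so the sum can fall only through its centring. This
one-sided control replaces continuity between grid points. -/
lemma centredSum_sub_le {C : Finset ι} {c : ι → ℝ → ℝ} {K n x y : ℝ}
    (hc : ∀ s, IsSlowCdf K (c s)) (hK : 0 ≤ K) (hC : C.card ≤ n) (hx : 0 ≤ x) (hxy : x ≤ y)
    (hy : y ≤ 1) (u : ι → ℝ) : centredSum C c x u - centredSum C c y u ≤ n * (K * (y - x)) := by
  have h0 : 0 ≤ K * (y - x) := mul_nonneg hK (by linarith)
  calc centredSum C c x u - centredSum C c y u
      ≤ ∑ s ∈ C, K * (y - x) := by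
        rw [centredSum, centredSum, ← Finset.sum_sub_distrib]
        refine Finset.sum_le_sum fun s _ => ?_
        obtain ⟨_, h1, _, h2⟩ := hc s x y hx hxy hy
        by_cases h : u s ≤ c s x
        · simp only [h, h.trans h1, if_true]; linarith
        · by_cases h' : u s ≤ c s y <;> simp only [h, h', if_true, if_false] <;> linarith
    _ = C.card * (K * (y - x)) := by simp
    _ ≤ n * (K * (y - x)) := by gcongr

variable {Ω : Type*} [MeasurableSpace Ω] {μ : Measure Ω} [IsProbabilityMeasure μ]

/-- Markov's inequality for the fourth power. The hypothesis `h1` lets the square of the variance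
bound absorb the linear term of the fourth moment, whence the factor `4 = 3 + 1`. -/
lemma measureReal_centredSum_sub_gt_le {U : ι → Ω → ℝ} (hU : ∀ s, Measurable (U s))
    (hu : ∀ s, μ.map (U s) = volume.restrict (Set.Ioo (0 : ℝ) 1)) (hi : iIndepFun U μ)
    {C : Finset ι} {c : ι → ℝ → ℝ} {K n x y β : ℝ}
    (hc : ∀ s, IsSlowCdf K (c s)) (hC : C.card ≤ n) (hx : 0 ≤ x) (hxy : x ≤ y)
    (hy : y ≤ 1) (h1 : 1 ≤ n * (K * (y - x))) (hβ : 0 < β) :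
    μ.real ((fun ω s => U s ω) ⁻¹' {u | β < |centredSum C c y u - centredSum C c x u|})
      ≤ 4 * (n * (K * (y - x))) ^ 2 / β ^ 4 := by
  set φ : ι → ℝ → ℝ := fun s v =>
    ((if v ≤ c s y then (1 : ℝ) else 0) - c s y) - ((if v ≤ c s x then (1 : ℝ) else 0) - c s x)
    with hφ
  have hφm : ∀ s, Measurable (φ s) := fun s =>
    ((Measurable.ite measurableSet_Iic measurable_const measurable_const).sub_const _).sub
      ((Measurable.ite measurableSet_Iic measurable_const measurable_const).sub_const _)
  have hmain : ∀ s, (∀ ω, |φ s (U s ω)| ≤ 1) ∧ ∫ ω, φ s (U s ω) ∂μ = 0 ∧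
      ∫ ω, φ s (U s ω) ^ 2 ∂μ ≤ c s y - c s x := fun s => by
    obtain ⟨ha, hab, hb, _⟩ := hc s x y hx hxy hy
    exact integral_centred_indicator (hU s) (hu s) ha hab hb
  have hfi : iIndepFun (fun s ω => φ s (U s ω)) μ := hi.comp φ hφm
  obtain ⟨-, -, h4⟩ := moments_sum_of_iIndepFun hfi (fun s => (hφm s).comp (hU s))
    (fun s => (hmain s).1) (fun s => (hmain s).2.1) (p := K * (y - x))
    (fun s => (hmain s).2.2.trans (hc s x y hx hxy hy).2.2.2) C
  have hsum : ∀ ω, ∑ s ∈ C, φ s (U s ω)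
      = centredSum C c y (fun s => U s ω) - centredSum C c x (fun s => U s ω) := fun ω => by
    rw [centredSum, centredSum, ← Finset.sum_sub_distrib]
  simp only [hsum] at h4
  have hn : (0 : ℝ) ≤ n := (Nat.cast_nonneg _).trans hC
  have hp : 0 ≤ K * (y - x) := by
    by_contra h
    push Not at h
    nlinarith
  have hCn : C.card * (K * (y - x)) ≤ n * (K * (y - x)) := by gcongr
  have h0 : 0 ≤ C.card * (K * (y - x)) := by positivity
  have h4' : ∫ ω, (centredSum C c y (fun s => U s ω) - centredSum C c x (fun s => U s ω)) ^ 4 ∂μ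
      ≤ 4 * (n * (K * (y - x))) ^ 2 := by
    nlinarith
  have hmeas : Measurable fun ω =>
      centredSum C c y (fun s => U s ω) - centredSum C c x (fun s => U s ω) :=
    ((measurable_centredSum C c y).sub (measurable_centredSum C c x)).comp
      (measurable_pi_lambda _ hU)
  have hbd : ∀ ω, |centredSum C c y (fun s => U s ω) - centredSum C c x (fun s => U s ω)|
      ≤ C.card := fun ω => by
    rw [← hsum]
    refine (Finset.abs_sum_le_sum_abs _ _).trans ?_
    simpa using Finset.sum_le_sum fun s (_ : s ∈ C) => (hmain s).1 ω
  have hint := integrable_pow_mul_pow_of_bounded (μ := μ) hmeas hmeas hbd hbd 4 0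
  simp only [pow_zero, mul_one] at hint
  have hmk := mul_meas_ge_le_integral_of_nonneg (ae_of_all _ fun ω => by positivity) hint (β ^ 4)
  rw [le_div_iff₀ (by positivity), mul_comm]
  refine le_trans ?_ (hmk.trans h4')
  refine mul_le_mul_of_nonneg_left (measureReal_mono fun ω hω => ?_) (by positivity)
  have hω' : β < |centredSum C c y (fun s => U s ω) - centredSum C c x (fun s => U s ω)| := hω
  show β ^ 4 ≤ _
  rw [← Even.pow_abs (by decide : Even 4) (centredSum C c y _ - _)]
  exact pow_le_pow_left₀ hβ.le hω'.le 4

/-- On a window of length `ℓ` the centred sum oscillates by `O_P(√(n ℓ))`, uniformly over the index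
sets of at most `n` elements and the families of distribution functions with slopes at most `K`. -/
theorem exists_oscillation_bound {U : ι → Ω → ℝ} (hU : ∀ s, Measurable (U s))
    (hu : ∀ s, μ.map (U s) = volume.restrict (Set.Ioo (0 : ℝ) 1)) (hi : iIndepFun U μ)
    {K : ℝ} (hK : 1 ≤ K) {ε : ℝ} (hε : 0 < ε) :
    ∃ M : ℝ, 0 < M ∧ ∀ (C : Finset ι) (c : ι → ℝ → ℝ) (n a ℓ : ℝ), (∀ s, IsSlowCdf K (c s)) →
      C.card ≤ n → 0 ≤ a → 0 ≤ ℓ → a + ℓ ≤ 1 → 1 ≤ n * ℓ →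
      ∃ S : Set (ι → ℝ), MeasurableSet S ∧ μ.real ((fun ω s => U s ω) ⁻¹' S) ≤ ε ∧
        ∀ u ∉ S, ∀ t ∈ Set.Icc a (a + ℓ),
          |centredSum C c t u - centredSum C c a u| ≤ M * √(n * ℓ) := by
  -- The union bound below totals at most `20 / θ ^ 4`, which this choice brings below `ε`.
  set θ : ℝ := 20 / ε + 1 with hθ
  have hθ1 : 1 ≤ θ := by rw [hθ]; have : 0 ≤ 20 / ε := by positivity
                         linarith
  refine ⟨10 * (K * θ) + 2 * K, by positivity, fun C c n a ℓ hc hC ha hℓ haℓ hn => ?_⟩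
  -- The finest mesh `ℓ / 2 ^ m` satisfies `1 ≤ n * ℓ / 2 ^ m < 2`: coarse enough for the fourth
  -- moment bound at every level, fine enough for rounding to the grid to cost at most `2 * K`.
  obtain ⟨m, hm1, hm2⟩ := exists_nat_pow_near hn one_lt_two
  have hn0 : 0 ≤ n := (Nat.cast_nonneg _).trans hC
  set R := √(n * ℓ) with hR
  have hR2 : R ^ 2 = n * ℓ := Real.sq_sqrt (by linarith)
  have hR1 : 1 ≤ R := Real.one_le_sqrt.2 hn
  set t : ℕ → ℝ := fun i => a + ℓ * (i / 2 ^ m) with ht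
  -- The ratio `r = 9 / 10` satisfies both requirements of chaining: `∑ r ^ j = 10` is finite, and
  -- since `r ^ 4 > 1 / 2` the `2 ^ j` events of level `j`, each of probability of order `(1 / 4) ^
  -- j / r ^ (4 * j)`, have a summable total.
  set β : ℕ → ℝ := fun j => K * θ * R * (9 / 10) ^ j with hβ
  have hβ0 : ∀ j, 0 < β j := fun j => by rw [hβ]; positivity
  have h2m : (0 : ℝ) < 2 ^ m := by positivity
  have tmono : ∀ {i j : ℕ}, i ≤ j → t i ≤ t j := fun {i j} hij => by
    have : (i : ℝ) ≤ j := Nat.cast_le.2 hij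
    simp only [ht]; gcongr
  have t0 : t 0 = a := by simp [ht]
  have t1 : t (2 ^ m) = a + ℓ := by simp [ht]
  set T : ℕ → ℕ → Set (ι → ℝ) := fun j i =>
    {u | β j < |centredSum C c (t ((i + 1) * 2 ^ (m - j))) u
      - centredSum C c (t (i * 2 ^ (m - j))) u|} with hT
  refine ⟨⋃ j ∈ Finset.range (m + 1), ⋃ i ∈ Finset.range (2 ^ j), T j i, ?_, ?_, ?_⟩
  · refine Finset.measurableSet_biUnion _ fun j _ => Finset.measurableSet_biUnion _ fun i _ => ?_
    exact measurableSet_lt measurable_const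
      ((measurable_centredSum C c _).sub (measurable_centredSum C c _)).abs
  · have hone : ∀ j ∈ Finset.range (m + 1), ∀ i ∈ Finset.range (2 ^ j),
        μ.real ((fun ω s => U s ω) ⁻¹' T j i)
          ≤ 4 / θ ^ 4 * ((1 / 4) / (9 / 10) ^ 4) ^ j := by
      intro j hj i hi'
      rw [Finset.mem_range] at hj hi'
      have hjm : 2 ^ j * 2 ^ (m - j) = 2 ^ m := by rw [← pow_add]; congr 1; omega
      have hle : (i + 1) * 2 ^ (m - j) ≤ 2 ^ m := by
        rw [← hjm]; exact Nat.mul_le_mul_right _ hi'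
      have hdiff : t ((i + 1) * 2 ^ (m - j)) - t (i * 2 ^ (m - j)) = ℓ * (1 / 2) ^ j := by
        have hjm' : (2 : ℝ) ^ j * 2 ^ (m - j) = 2 ^ m := by exact_mod_cast hjm
        simp only [ht]; push_cast
        rw [← hjm', one_div, inv_pow]
        field_simp
        ring
      have hbase : 1 ≤ n * (K * (t ((i + 1) * 2 ^ (m - j)) - t (i * 2 ^ (m - j)))) := by
        rw [hdiff]
        have h3 : (1 : ℝ) ≤ n * ℓ * (1 / 2) ^ j := by
          have : (2 : ℝ) ^ j ≤ n * ℓ := le_trans (by gcongr; norm_num; omega) hm1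
          rw [one_div, inv_pow, ← div_eq_mul_inv, le_div_iff₀ (by positivity)]
          linarith
        nlinarith
      refine (measureReal_centredSum_sub_gt_le hU hu hi hc hC ?_ (tmono (by gcongr; omega)) ?_
        hbase (hβ0 j)).trans ?_
      · rw [← t0] at ha; exact ha.trans (tmono (Nat.zero_le _))
      · exact (tmono hle).trans (t1.trans_le haℓ)
      · rw [hdiff]
        have e1 : 4 * (n * (K * (ℓ * (1 / 2) ^ j))) ^ 2 / β j ^ 4
            = 1 / K ^ 2 * (4 / θ ^ 4 * ((1 / 4) / (9 / 10) ^ 4) ^ j) := by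
          have e2 : 4 * (n * (K * (ℓ * (1 / 2) ^ j))) ^ 2 = 4 * K ^ 2 * R ^ 4 * (1 / 4) ^ j := by
            rw [show R ^ 4 = (R ^ 2) ^ 2 by ring, hR2,
              show (1 / 4 : ℝ) ^ j = ((1 / 2) ^ j) ^ 2 by rw [← pow_mul, mul_comm, pow_mul]; norm_num]
            ring
          rw [e2, hβ, div_pow (1 / 4 : ℝ)]
          simp only [mul_pow]
          rw [← pow_mul, ← pow_mul, mul_comm j 4]
          field_simp
        rw [e1]
        refine mul_le_of_le_one_left (by positivity) ?_
        rw [div_le_one (by positivity)]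
        nlinarith
    simp only [Set.preimage_iUnion]
    calc _ ≤ ∑ j ∈ Finset.range (m + 1), ∑ i ∈ Finset.range (2 ^ j),
          4 / θ ^ 4 * ((1 / 4) / (9 / 10) ^ 4) ^ j :=
          (measureReal_biUnion_finset_le _ _).trans (Finset.sum_le_sum fun j hj =>
            (measureReal_biUnion_finset_le _ _).trans (Finset.sum_le_sum fun i hi' =>
              hone j hj i hi'))
      _ = 4 / θ ^ 4 * ∑ j ∈ Finset.range (m + 1), ((1 / 2) / (9 / 10) ^ 4 : ℝ) ^ j := by
          rw [Finset.mul_sum]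
          refine Finset.sum_congr rfl fun j _ => ?_
          rw [Finset.sum_const, Finset.card_range, nsmul_eq_mul,
            show ((1 / 2) / (9 / 10) ^ 4 : ℝ) = 2 * ((1 / 4) / (9 / 10) ^ 4) by norm_num, mul_pow]
          push_cast; ring
      _ ≤ 4 / θ ^ 4 * 5 := by
          gcongr
          refine (Summable.sum_le_tsum _ (fun _ _ => by positivity)
            (summable_geometric_of_lt_one (by positivity) (by norm_num))).trans ?_
          rw [tsum_geometric_of_lt_one (by positivity) (by norm_num)]
          norm_num
      _ ≤ ε := by
          have h4 : θ ≤ θ ^ 4 := le_self_pow₀ hθ1 (by norm_num)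
          have h5 : 20 ≤ ε * θ := by rw [hθ]; field_simp; linarith
          rw [div_mul_eq_mul_div, div_le_iff₀ (by positivity)]
          nlinarith
  · intro u hu' s hs
    simp only [Set.mem_iUnion, not_exists, Finset.mem_range] at hu'
    have hgrid : ∀ i ≤ 2 ^ m, |centredSum C c (t i) u - centredSum C c a u| ≤ 10 * (K * θ * R) := by
      intro i hi'
      have := abs_sub_le_sum_of_dyadic β (fun j => (hβ0 j).le) m
        (fun i => centredSum C c (t i) u)
        (fun j hj i hij => not_lt.1 (hu' j (by omega) i hij)) i hi'
      rw [t0] at this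
      refine this.trans ?_
      rw [hβ, ← Finset.mul_sum, mul_comm (10 : ℝ)]
      gcongr
      refine (Summable.sum_le_tsum _ (fun _ _ => by positivity)
        (summable_geometric_of_lt_one (by positivity) (by norm_num))).trans ?_
      rw [tsum_geometric_of_lt_one (by positivity) (by norm_num)]
      norm_num
    have hℓ0 : 0 < ℓ := by
      rcases hℓ.eq_or_lt with h | h
      · rw [← h] at hn; norm_num at hn
      · exact h
    have hstep : ∀ i : ℕ, t (i + 1) - t i = ℓ / 2 ^ m := fun i => by
      simp only [ht]; push_cast; field_simp; ring
    have hsmall : n * (K * (ℓ / 2 ^ m)) ≤ 2 * K * R := by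
      have : n * ℓ / 2 ^ m ≤ 2 := by rw [div_le_iff₀ h2m]; rw [pow_succ] at hm2; linarith
      calc n * (K * (ℓ / 2 ^ m)) = K * (n * ℓ / 2 ^ m) := by ring
        _ ≤ K * 2 := by gcongr
        _ ≤ 2 * K * R := by nlinarith
    set i := ⌊(s - a) / ℓ * 2 ^ m⌋₊ with hidef
    have hnn : 0 ≤ (s - a) / ℓ * 2 ^ m := by
      have := hs.1
      exact mul_nonneg (div_nonneg (by linarith) hℓ) h2m.le
    have hlow : t i ≤ s := by
      have h1 : (i : ℝ) ≤ (s - a) / ℓ * 2 ^ m := Nat.floor_le hnn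
      have h2 : (i : ℝ) / 2 ^ m ≤ (s - a) / ℓ := by rwa [div_le_iff₀ h2m]
      rw [le_div_iff₀ hℓ0] at h2
      simp only [ht]; linarith
    have hup : s < t (i + 1) := by
      have h1 : (s - a) / ℓ * 2 ^ m < i + 1 := Nat.lt_floor_add_one _
      rw [← lt_div_iff₀ h2m, div_lt_iff₀ hℓ0] at h1
      simp only [ht]; push_cast; linarith
    have htle : ∀ i ≤ 2 ^ m, t i ≤ 1 := fun i hi' => (tmono hi').trans (t1.trans_le haℓ)
    have htge : ∀ i, 0 ≤ t i := fun i => ha.trans (t0 ▸ tmono (Nat.zero_le i))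
    have him : i ≤ 2 ^ m := by
      by_contra h
      push Not at h
      have h1 : t (2 ^ m + 1) ≤ t i := tmono h
      have h2 := hstep (2 ^ m)
      have h3 : 0 < ℓ / 2 ^ m := by positivity
      linarith [hs.2]
    -- From below compare with the grid point to the left of `s`, from above with the one to the
    -- right; if `i = 2 ^ m`, then `s` is itself the last grid point.
    have hlo : -(10 * (K * θ * R) + 2 * K * R) ≤ centredSum C c s u - centredSum C c a u := by
      have h1 := centredSum_sub_le hc (by linarith) hC (htge i) hlow (hs.2.trans haℓ) u
      have h2 : n * (K * (s - t i)) ≤ n * (K * (ℓ / 2 ^ m)) := by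
        have := hstep i
        gcongr
        linarith
      have h3 := (abs_le.1 (hgrid i him)).1
      linarith
    have hhi : centredSum C c s u - centredSum C c a u ≤ 10 * (K * θ * R) + 2 * K * R := by
      rcases him.eq_or_lt with h | h
      · have : s = t i := le_antisymm (by rw [h, t1]; exact hs.2) hlow
        have h3 := (abs_le.1 (hgrid i him)).2
        rw [← this] at h3
        have : 0 ≤ K * R := by positivity
        linarith
      · have h1 := centredSum_sub_le hc (by linarith) hC (ha.trans hs.1) hup.le (htle _ h) u
        have h2 : n * (K * (t (i + 1) - s)) ≤ n * (K * (ℓ / 2 ^ m)) := by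
          have := hstep i
          gcongr
          linarith
        have h3 := (abs_le.1 (hgrid _ h)).2
        linarith
    rw [abs_le]
    constructor <;> linarith

end Oscillation

/-! ### Conditioning on the field of hypotheses. -/

section Conditioning

variable {ι Ω : Type*} [MeasurableSpace Ω] {μ : Measure Ω} [IsProbabilityMeasure μ]

open Classical in
/-- A bound on the probability of an event for `U` that holds for every fixed subset of `C` also
holds for the random subset `{s ∈ C | H s = 1}` if `H` is independent of `U`. -/
lemma measureReal_mem_random_finset_le {H U : ι → Ω → ℝ} (hH : ∀ s, Measurable (H s))
    (hind : IndepFun (fun ω s => U s ω) (fun ω s => H s ω) μ) (C : Finset ι)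
    (S : Finset ι → Set (ι → ℝ)) (hS : ∀ A, MeasurableSet (S A)) {ε : ℝ}
    (hε : ∀ A, μ.real ((fun ω s => U s ω) ⁻¹' S A) ≤ ε) :
    μ.real {ω | (fun s => U s ω) ∈ S (C.filter fun s => H s ω = 1)} ≤ ε := by
  -- The random subset takes finitely many values `A ⊆ C`; on each of these disjoint events
  -- independence factors the probability, so no conditional distribution is required.
  set T : Finset ι → Set (ι → ℝ) := fun A => {h | C.filter (fun s => h s = 1) = A} with hT
  have hTm : ∀ A ∈ C.powerset, MeasurableSet (T A) := fun A hA => by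
    have : T A = ⋂ s ∈ C, {h : ι → ℝ | h s = 1 ↔ s ∈ A} := by
      ext h
      simp only [hT, Set.mem_ofPred_eq, Set.mem_iInter, Finset.ext_iff, Finset.mem_filter]
      rw [Finset.mem_powerset] at hA
      exact ⟨fun e s hs => by simpa [hs] using e s,
        fun e s => ⟨fun hs => (e s hs.1).1 hs.2, fun hs => ⟨hA hs, (e s (hA hs)).2 hs⟩⟩⟩
    rw [this]
    refine Finset.measurableSet_biInter _ fun s _ => ?_
    have h1 : MeasurableSet {h : ι → ℝ | h s = 1} := measurable_pi_apply s (measurableSet_singleton 1)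
    by_cases hs : s ∈ A
    · simpa [hs] using h1
    · have e : {h : ι → ℝ | h s = 1 ↔ s ∈ A} = {h : ι → ℝ | h s = 1}ᶜ := by ext h; simp [hs]
      exact e ▸ h1.compl
  have hHm : Measurable fun ω s => H s ω := measurable_pi_lambda _ hH
  have hsub : {ω | (fun s => U s ω) ∈ S (C.filter fun s => H s ω = 1)} ⊆
      ⋃ A ∈ C.powerset, ((fun ω s => U s ω) ⁻¹' S A ∩ (fun ω s => H s ω) ⁻¹' T A) := fun ω hω => by
    simp only [Set.mem_iUnion]
    exact ⟨C.filter fun s => H s ω = 1, Finset.mem_powerset.2 (Finset.filter_subset _ _), hω, rfl⟩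
  have h1 : ∀ A, 0 ≤ μ.real ((fun ω s => H s ω) ⁻¹' T A) := fun A => measureReal_nonneg
  calc _ ≤ ∑ A ∈ C.powerset,
        μ.real ((fun ω s => U s ω) ⁻¹' S A ∩ (fun ω s => H s ω) ⁻¹' T A) :=
        (measureReal_mono hsub (measure_ne_top _ _)).trans (measureReal_biUnion_finset_le _ _)
    _ ≤ ∑ A ∈ C.powerset, ε * μ.real ((fun ω s => H s ω) ⁻¹' T A) := by
        refine Finset.sum_le_sum fun A hA => ?_
        rw [measureReal_def, hind.measure_inter_preimage_eq_mul _ _ (hS A) (hTm A hA),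
          ENNReal.toReal_mul]
        exact mul_le_mul_of_nonneg_right (hε A) (h1 A)
    _ = ε * μ.real (⋃ A ∈ C.powerset, (fun ω s => H s ω) ⁻¹' T A) := by
        rw [← Finset.mul_sum, measureReal_biUnion_finset]
        · intro A _ A' _ hAA'
          refine Set.disjoint_left.2 fun ω hω hω' => hAA' ?_
          exact (hω : _ = A).symm.trans (hω' : _ = A')
        · exact fun A hA => hHm (hTm A hA)
    _ ≤ ε := by
        have h0 : 0 ≤ ε := measureReal_nonneg.trans (hε ∅)
        exact mul_le_of_le_one_right h0 measureReal_le_one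

end Conditioning

/-! ### The alternative distribution function and its quantile. -/

section AltCdf

variable {G g : ℝ → ℝ}

lemma IsAltCdf.density_nonneg (hG : IsAltCdf G g) {x : ℝ} (hx : x ∈ Set.Icc (0 : ℝ) 1) :
    0 ≤ g x :=
  HasDerivWithinAt.nonneg_of_monotoneOn
    ((uniqueDiffOn_Icc zero_lt_one) x hx).accPt (hG.deriv x hx) hG.mono

lemma IsAltCdf.continuousOn (hG : IsAltCdf G g) : ContinuousOn G (Set.Icc 0 1) :=
  fun x hx => (hG.deriv x hx).continuousWithinAt

lemma IsAltCdf.exists_isSlowCdf (hG : IsAltCdf G g) : ∃ K : ℝ, 1 ≤ K ∧ IsSlowCdf K G := by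
  obtain ⟨K, hK⟩ := hG.bounded
  refine ⟨max K 1, le_max_right _ _, fun x y hx hxy hy => ?_⟩
  have mx : x ∈ Set.Icc (0 : ℝ) 1 := ⟨hx, hxy.trans hy⟩
  have my : y ∈ Set.Icc (0 : ℝ) 1 := ⟨hx.trans hxy, hy⟩
  have m0 : (0 : ℝ) ∈ Set.Icc (0 : ℝ) 1 := ⟨le_rfl, zero_le_one⟩
  have m1 : (1 : ℝ) ∈ Set.Icc (0 : ℝ) 1 := ⟨zero_le_one, le_rfl⟩
  refine ⟨hG.zero ▸ hG.mono m0 mx hx, hG.mono mx my hxy, hG.one ▸ hG.mono my m1 hy, ?_⟩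
  have hb : ∀ z ∈ Set.Icc (0 : ℝ) 1, ‖g z‖ ≤ max K 1 := fun z hz => by
    rw [Real.norm_of_nonneg (hG.density_nonneg hz)]; exact (hK z hz).trans (le_max_left _ _)
  have := Convex.norm_image_sub_le_of_norm_hasDerivWithin_le hG.deriv hb (convex_Icc 0 1) mx my
  rw [Real.norm_eq_abs, Real.norm_eq_abs, abs_of_nonneg (sub_nonneg.2 hxy)] at this
  exact (le_abs_self _).trans this

/-- By continuity of `G` the set defining the quantile is closed, so its infimum is attained; `u ≤
1` makes it nonempty. -/
lemma IsAltCdf.quantile_le_iff (hG : IsAltCdf G g) {u t : ℝ} (hu : u ≤ 1)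
    (ht : t ∈ Set.Icc (0 : ℝ) 1) : quantile G u ≤ t ↔ u ≤ G t := by
  set Q : Set ℝ := {x ∈ Set.Icc (0 : ℝ) 1 | u ≤ G x} with hQ
  have hbdd : BddBelow Q := ⟨0, fun x hx => hx.1.1⟩
  refine ⟨fun h => ?_, fun h => csInf_le hbdd ⟨ht, h⟩⟩
  have hcl : IsClosed Q := by
    have := hG.continuousOn.preimage_isClosed_of_isClosed isClosed_Icc (isClosed_Ici (a := u))
    exact this
  have hne : Q.Nonempty := ⟨1, ⟨zero_le_one, le_rfl⟩, by rw [hG.one]; exact hu⟩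
  have hmem := hcl.csInf_mem hne hbdd
  exact hmem.2.trans (hG.mono hmem.1 ht h)

end AltCdf

/-! ### The p-value model and its conditionally centred processes. -/

section Model

variable {Ω : Type*} {d : ℕ}

lemma card_cube (N : Fin d → ℕ) : (cube N).card = cubeSize N := by
  simp [cube, cubeSize, Fintype.card_piFinset]

lemma tendsto_cubeSize (hd : 0 < d) : Tendsto (cubeSize : (Fin d → ℕ) → ℕ) atTop atTop := by
  refine tendsto_atTop.2 fun m => ?_
  filter_upwards [eventually_ge_atTop (fun _ : Fin d => m + 1)] with N hN
  have hpos : 0 < cubeSize N := Finset.prod_pos fun k _ => (Nat.succ_pos m).trans_le (hN k)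
  have h1 : N ⟨0, hd⟩ ≤ cubeSize N :=
    Nat.le_of_dvd hpos (Finset.dvd_prod_of_mem N (Finset.mem_univ _))
  have h2 : m + 1 ≤ N ⟨0, hd⟩ := hN ⟨0, hd⟩
  omega

variable {H U X : (Fin d → ℤ) → Ω → ℝ} {G g : ℝ → ℝ}

lemma pvalue_le_iff (hG : IsAltCdf G g)
    (hX : ∀ s ω, X s ω = (1 - H s ω) * U s ω + H s ω * quantile G (U s ω))
    (h01 : ∀ s ω, H s ω = 0 ∨ H s ω = 1) {ω : Ω} (hω : ∀ s, U s ω ∈ Set.Ioo (0 : ℝ) 1)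
    (s : Fin d → ℤ) {t : ℝ} (ht : t ∈ Set.Icc (0 : ℝ) 1) :
    X s ω ≤ t ↔ U s ω ≤ if H s ω = 1 then G t else t := by
  rw [hX]
  rcases h01 s ω with h | h
  · simp [h]
  · simp [h, hG.quantile_le_iff (hω s).2.le ht]

/-- The empirical distribution function, centred given the field `H`. -/
noncomputable def centredCdf (H X : (Fin d → ℤ) → Ω → ℝ) (G : ℝ → ℝ) (N : Fin d → ℕ) (ω : Ω)
    (t : ℝ) : ℝ :=
  empCdf X N ω t -
    ((1 - falseNulls H N ω / cubeSize N) * t + falseNulls H N ω / cubeSize N * G t)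

/-- The empirical distribution function of the true nulls, centred given the field `H`. -/
noncomputable def centredNull (H X : (Fin d → ℤ) → Ω → ℝ) (N : Fin d → ℕ) (ω : Ω) (t : ℝ) : ℝ :=
  empNull H X N ω t - (1 - falseNulls H N ω / cubeSize N) * t

lemma centredCdf_eq (hG : IsAltCdf G g)
    (hX : ∀ s ω, X s ω = (1 - H s ω) * U s ω + H s ω * quantile G (U s ω))
    (h01 : ∀ s ω, H s ω = 0 ∨ H s ω = 1) {N : Fin d → ℕ} (hN : 0 < cubeSize N) {ω : Ω}
    (hω : ∀ s, U s ω ∈ Set.Ioo (0 : ℝ) 1) {t : ℝ} (ht : t ∈ Set.Icc (0 : ℝ) 1) :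
    centredCdf H X G N ω t =
      (∑ s ∈ cube N, ((if U s ω ≤ (if H s ω = 1 then G t else t) then (1 : ℝ) else 0)
        - if H s ω = 1 then G t else t)) / cubeSize N := by
  have hn : (cubeSize N : ℝ) ≠ 0 := by positivity
  have e1 : ∀ s ∈ cube N, (if H s ω = 1 then G t else t) = t + H s ω * (G t - t) := fun s _ => by
    rcases h01 s ω with h | h <;> simp [h]
  have e2 : ∑ s ∈ cube N, (if H s ω = 1 then G t else t)
      = cubeSize N * t + falseNulls H N ω * (G t - t) := by
    rw [Finset.sum_congr rfl e1, Finset.sum_add_distrib, ← Finset.sum_mul, Finset.sum_const,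
      card_cube, nsmul_eq_mul, falseNulls]
  rw [Finset.sum_sub_distrib, e2, centredCdf, empCdf]
  simp only [pvalue_le_iff hG hX h01 hω _ ht]
  field_simp
  ring

/-- Giving the false nulls the threshold `0` removes them from the sum, because `U s > 0`. Hence the
oscillation bound applies with the pair `t ↦ t`, `t ↦ 0`. -/
lemma centredNull_eq (hX : ∀ s ω, X s ω = (1 - H s ω) * U s ω + H s ω * quantile G (U s ω))
    (h01 : ∀ s ω, H s ω = 0 ∨ H s ω = 1) {N : Fin d → ℕ} (hN : 0 < cubeSize N) {ω : Ω}
    (hω : ∀ s, U s ω ∈ Set.Ioo (0 : ℝ) 1) (t : ℝ) :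
    centredNull H X N ω t =
      (∑ s ∈ cube N, ((if U s ω ≤ (if H s ω = 1 then 0 else t) then (1 : ℝ) else 0)
        - if H s ω = 1 then 0 else t)) / cubeSize N := by
  have hn : (cubeSize N : ℝ) ≠ 0 := by positivity
  have e1 : ∀ s ∈ cube N, (if H s ω = 1 then 0 else t) = t - H s ω * t := fun s _ => by
    rcases h01 s ω with h | h <;> simp [h]
  have e2 : ∑ s ∈ cube N, (if H s ω = 1 then 0 else t)
      = cubeSize N * t - falseNulls H N ω * t := by
    rw [Finset.sum_congr rfl e1, Finset.sum_sub_distrib, ← Finset.sum_mul, Finset.sum_const,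
      card_cube, nsmul_eq_mul, falseNulls]
  have e3 : ∀ s ∈ cube N, (1 - H s ω) * (if X s ω ≤ t then (1 : ℝ) else 0)
      = if U s ω ≤ (if H s ω = 1 then 0 else t) then (1 : ℝ) else 0 := fun s _ => by
    rw [hX]
    rcases h01 s ω with h | h
    · simp [h]
    · simp [h, (hω s).1]
  rw [Finset.sum_sub_distrib, e2, centredNull, empNull, Finset.sum_congr rfl e3]
  field_simp

lemma isSlowCdf_id {K : ℝ} (hK : 1 ≤ K) : IsSlowCdf K fun t => t :=
  fun x y hx hxy hy => ⟨hx, hxy, hy, le_mul_of_one_le_left (by linarith) hK⟩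

lemma isSlowCdf_zero {K : ℝ} (hK : 1 ≤ K) : IsSlowCdf K fun _ => 0 :=
  fun x y hx hxy hy => ⟨le_rfl, le_rfl, zero_le_one,
    by rw [sub_zero]; exact mul_nonneg (by linarith) (by linarith)⟩

variable [MeasurableSpace Ω] {μ : Measure Ω}

lemma IsUniformNoise.ae_mem_Ioo (hU : IsUniformNoise μ H U) :
    ∀ᵐ ω ∂μ, ∀ s, U s ω ∈ Set.Ioo (0 : ℝ) 1 := by
  refine ae_all_iff.2 fun s => ae_of_ae_map (hU.measurable s).aemeasurable ?_
  rw [hU.uniform s]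
  exact ae_restrict_mem measurableSet_Ioo

variable [IsProbabilityMeasure μ]

/-- Oscillation of the sums of the indicators of `{U s ≤ c_{H s} t}`, centred given the field `H`. -/
lemma exists_conditional_oscillation_bound
    (hH : ∀ s, Measurable (H s)) (hU : IsUniformNoise μ H U) {K : ℝ} (hK : 1 ≤ K)
    {c₀ c₁ : ℝ → ℝ} (h₀ : IsSlowCdf K c₀) (h₁ : IsSlowCdf K c₁) {ε : ℝ} (hε : 0 < ε) :
    ∃ M : ℝ, 0 < M ∧ ∀ (N : Fin d → ℕ) (a ℓ : ℝ), 0 ≤ a → 0 ≤ ℓ → a + ℓ ≤ 1 →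
      1 ≤ cubeSize N * ℓ → ∃ B : Set Ω, μ.real B ≤ ε ∧ ∀ ω ∉ B,
        (∀ s, U s ω ∈ Set.Ioo (0 : ℝ) 1) ∧ ∀ t ∈ Set.Icc a (a + ℓ),
          |(∑ s ∈ cube N, ((if U s ω ≤ (if H s ω = 1 then c₁ t else c₀ t) then (1 : ℝ) else 0)
              - if H s ω = 1 then c₁ t else c₀ t))
            - ∑ s ∈ cube N, ((if U s ω ≤ (if H s ω = 1 then c₁ a else c₀ a) then (1 : ℝ) else 0)
              - if H s ω = 1 then c₁ a else c₀ a)| ≤ M * √(cubeSize N * ℓ) := by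
  classical
  obtain ⟨M, hM, hosc⟩ := exists_oscillation_bound hU.measurable hU.uniform hU.iIndep hK hε
  refine ⟨M, hM, fun N a ℓ ha hℓ haℓ hn => ?_⟩
  have hc : ∀ (A : Finset (Fin d → ℤ)) s, IsSlowCdf K (if s ∈ A then c₁ else c₀) :=
    fun A s => by split_ifs <;> assumption
  choose S hSm hSε hS using fun A : Finset (Fin d → ℤ) =>
    hosc (cube N) (fun s => if s ∈ A then c₁ else c₀) (cubeSize N) a ℓ (hc A)
      (by rw [card_cube]) ha hℓ haℓ hn
  refine ⟨{ω | (fun s => U s ω) ∈ S ((cube N).filter fun s => H s ω = 1)} ∪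
    {ω | ¬ ∀ s, U s ω ∈ Set.Ioo (0 : ℝ) 1}, ?_, fun ω hω => ?_⟩
  · refine (measureReal_union_le _ _).trans ?_
    have h0 : μ.real {ω | ¬ ∀ s, U s ω ∈ Set.Ioo (0 : ℝ) 1} = 0 := by
      rw [measureReal_def, ae_iff.1 hU.ae_mem_Ioo, ENNReal.toReal_zero]
    rw [h0, add_zero]
    exact measureReal_mem_random_finset_le hH hU.indep_field (cube N) S hSm hSε
  · rw [Set.mem_union, not_or] at hω
    refine ⟨not_not.1 hω.2, fun t ht => ?_⟩
    have key : ∀ x, centredSum (cube N)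
        (fun s => if s ∈ (cube N).filter (fun s => H s ω = 1) then c₁ else c₀) x (fun s => U s ω)
        = ∑ s ∈ cube N, ((if U s ω ≤ (if H s ω = 1 then c₁ x else c₀ x) then (1 : ℝ) else 0)
              - if H s ω = 1 then c₁ x else c₀ x) := fun x => by
      refine Finset.sum_congr rfl fun s hs => ?_
      by_cases h : H s ω = 1 <;> simp [hs, h]
    have := hS _ _ hω.1 t ht
    rwa [key, key] at this

/-- The zeros at `0` and `1` turn oscillation bounds into bounds on the process itself: on all of
`[0, 1]` from `0`, and in a short window next to `1`. -/
lemma exists_centredCdf_bound (hH : ∀ s, Measurable (H s)) (h01 : ∀ s ω, H s ω = 0 ∨ H s ω = 1)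
    (hU : IsUniformNoise μ H U) (hG : IsAltCdf G g)
    (hX : ∀ s ω, X s ω = (1 - H s ω) * U s ω + H s ω * quantile G (U s ω))
    {ε : ℝ} (hε : 0 < ε) :
    ∃ M : ℝ, 0 < M ∧ ∀ (N : Fin d → ℕ) (a ℓ : ℝ), 0 ≤ a → 0 ≤ ℓ → a + ℓ ≤ 1 →
      1 ≤ cubeSize N * ℓ → ∃ B : Set Ω, μ.real B ≤ ε ∧ ∀ ω ∉ B,
        centredCdf H X G N ω 0 = 0 ∧ centredCdf H X G N ω 1 = 0 ∧
        ∀ t ∈ Set.Icc a (a + ℓ), |centredCdf H X G N ω t - centredCdf H X G N ω a|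
          ≤ M * (√(cubeSize N * ℓ) / cubeSize N) := by
  obtain ⟨K, hK, hGK⟩ := hG.exists_isSlowCdf
  obtain ⟨M, hM, h⟩ := exists_conditional_oscillation_bound hH hU hK (isSlowCdf_id hK) hGK hε
  refine ⟨M, hM, fun N a ℓ ha hℓ haℓ hn => ?_⟩
  have hN : 0 < cubeSize N := by
    rcases Nat.eq_zero_or_pos (cubeSize N) with h0 | h0
    · rw [h0] at hn; norm_num at hn
    · exact h0
  obtain ⟨B, hB, hosc⟩ := h N a ℓ ha hℓ haℓ hn
  refine ⟨B, hB, fun ω hω => ?_⟩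
  obtain ⟨hω1, hω2⟩ := hosc ω hω
  have hEq := fun {t : ℝ} ht => centredCdf_eq (t := t) hG hX h01 hN hω1 ht
  refine ⟨?_, ?_, fun t ht => ?_⟩
  · rw [hEq ⟨le_rfl, zero_le_one⟩]
    simp [hG.zero, fun s => (hω1 s).1]
  · rw [hEq ⟨zero_le_one, le_rfl⟩]
    simp [hG.one, fun s => (hω1 s).2.le]
  · rw [hEq ⟨ha.trans ht.1, ht.2.trans haℓ⟩, hEq ⟨ha, by linarith⟩, ← sub_div, abs_div,
      Nat.abs_cast, ← mul_div_assoc]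
    gcongr
    exact hω2 t ht

lemma exists_centredNull_bound (hH : ∀ s, Measurable (H s)) (h01 : ∀ s ω, H s ω = 0 ∨ H s ω = 1)
    (hU : IsUniformNoise μ H U)
    (hX : ∀ s ω, X s ω = (1 - H s ω) * U s ω + H s ω * quantile G (U s ω))
    {ε : ℝ} (hε : 0 < ε) :
    ∃ M : ℝ, 0 < M ∧ ∀ N : Fin d → ℕ, 0 < cubeSize N → ∃ B : Set Ω, μ.real B ≤ ε ∧ ∀ ω ∉ B,
        ∀ t ∈ Set.Icc (0 : ℝ) 1, |centredNull H X N ω t| ≤ M * (√(cubeSize N) / cubeSize N) := by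
  obtain ⟨M, hM, h⟩ := exists_conditional_oscillation_bound hH hU le_rfl (isSlowCdf_id le_rfl)
    (isSlowCdf_zero le_rfl) hε
  refine ⟨M, hM, fun N hN => ?_⟩
  have hN1 : (1 : ℝ) ≤ cubeSize N := by exact_mod_cast hN
  obtain ⟨B, hB, hosc⟩ := h N 0 1 le_rfl zero_le_one (by norm_num) (by simpa using hN1)
  refine ⟨B, hB, fun ω hω t ht => ?_⟩
  obtain ⟨hω1, hω2⟩ := hosc ω hω
  rw [centredNull_eq hX h01 hN hω1, abs_div, Nat.abs_cast, ← mul_div_assoc]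
  gcongr
  have := hω2 t (by simpa using ht)
  simpa [fun s => not_le.2 (hω1 s).1] using this

/-- The proportion of false nulls is `√n`-consistent. -/
lemma exists_falseNulls_bound (hd : 0 < d) (hH : Condition1 μ H) {ε : ℝ} (hε : 0 < ε) :
    ∃ M : ℝ, 0 < M ∧ ∀ᶠ N : Fin d → ℕ in atTop, ∃ B : Set Ω, μ.real B ≤ ε ∧ ∀ ω ∉ B,
      |falseNulls H N ω / cubeSize N - (1 - nullProp μ H)|
        ≤ M * (√(cubeSize N) / cubeSize N) := by
  obtain ⟨c, hc, hb⟩ := hH.l2_bound.exists_pos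
  refine ⟨c * √(1 / ε), by positivity, ?_⟩
  filter_upwards [hb.bound, (tendsto_cubeSize hd).eventually_gt_atTop 0] with N hN hpos
  have hn : (0 : ℝ) < cubeSize N := by exact_mod_cast hpos
  set Y : Ω → ℝ := fun ω => falseNulls H N ω - cubeSize N * (1 - nullProp μ H) with hY
  have hYm : Measurable Y :=
    (Finset.measurable_sum _ fun s _ => hH.measurable s).sub measurable_const
  have hYb : ∀ ω, |Y ω| ≤ cubeSize N + |cubeSize N * (1 - nullProp μ H)| := fun ω => by
    refine (abs_sub _ _).trans (add_le_add_left ?_ _)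
    refine (Finset.abs_sum_le_sum_abs _ _).trans ?_
    rw [← card_cube]
    have : ∀ s ∈ cube N, |H s ω| ≤ 1 := fun s _ => by
      rcases hH.zero_or_one s ω with h | h <;> simp [h]
    simpa using Finset.sum_le_sum this
  have hint := integrable_pow_mul_pow_of_bounded (μ := μ) hYm hYm hYb hYb 2 0
  simp only [pow_zero, mul_one] at hint
  have h2 : ∫ ω, Y ω ^ 2 ∂μ ≤ c ^ 2 * cubeSize N := by
    rw [Real.norm_of_nonneg (Real.sqrt_nonneg _), Real.norm_of_nonneg (Real.sqrt_nonneg _)] at hN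
    have h3 : 0 ≤ ∫ ω, Y ω ^ 2 ∂μ := integral_nonneg fun ω => sq_nonneg _
    have h4 := pow_le_pow_left₀ (Real.sqrt_nonneg _) hN 2
    rwa [Real.sq_sqrt h3, mul_pow, Real.sq_sqrt hn.le] at h4
  -- Chebyshev's inequality: the second moment is at most `c ^ 2 * n`.
  refine ⟨{ω | c ^ 2 * (1 / ε) * cubeSize N ≤ Y ω ^ 2}, ?_, fun ω hω => ?_⟩
  · have hmk := (mul_meas_ge_le_integral_of_nonneg (ae_of_all _ fun ω => sq_nonneg (Y ω)) hint
      (c ^ 2 * (1 / ε) * cubeSize N)).trans h2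
    have hp : 0 < c ^ 2 * cubeSize N := by positivity
    have e : c ^ 2 * (1 / ε) * cubeSize N * μ.real {ω | c ^ 2 * (1 / ε) * cubeSize N ≤ Y ω ^ 2}
        = c ^ 2 * cubeSize N * (μ.real {ω | c ^ 2 * (1 / ε) * cubeSize N ≤ Y ω ^ 2} / ε) := by ring
    rw [e] at hmk
    have := le_of_mul_le_mul_left (hmk.trans_eq (mul_one _).symm) hp
    rwa [div_le_one hε] at this
  · have h3 : Y ω ^ 2 ≤ (c * √(1 / ε) * √(cubeSize N)) ^ 2 := by
      rw [mul_pow, mul_pow, Real.sq_sqrt (by positivity), Real.sq_sqrt hn.le]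
      exact (not_le.1 hω).le
    have h4 := abs_le_of_sq_le_sq h3 (by positivity)
    have h5 : falseNulls H N ω / cubeSize N - (1 - nullProp μ H) = Y ω / cubeSize N := by
      rw [hY]; field_simp
    rw [h5, abs_div, Nat.abs_cast, ← mul_div_assoc]
    gcongr

end Model

/-! ### Last crossing of a line and a monotone function. -/

section Threshold

variable {α p t : ℝ} {Φ : ℝ → ℝ}

lemma le_threshold (ht : t ∈ Set.Icc (0 : ℝ) 1) (h : t * p / α ≤ Φ t) : t ≤ threshold α p Φ :=
  le_csSup ⟨1, fun _ hx => hx.1.2⟩ ⟨ht, h⟩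

lemma lt_of_threshold_lt (h0 : 0 ≤ t) (h1 : t ≤ 1) (h : threshold α p Φ < t) :
    Φ t < t * p / α := by
  by_contra hlt
  exact absurd (le_threshold ⟨h0, h1⟩ (not_lt.1 hlt)) (not_le.2 h)

lemma threshold_mem (h0 : 0 ≤ Φ 0) : threshold α p Φ ∈ Set.Icc (0 : ℝ) 1 :=
  ⟨le_threshold ⟨le_rfl, zero_le_one⟩ (by simpa using h0),
    csSup_le ⟨0, ⟨le_rfl, zero_le_one⟩, by simpa using h0⟩ fun _ hx => hx.1.2⟩

/-- Monotonicity alone suffices: points of the set approaching the supremum have values of `Φ` at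
most the value at the supremum, and the line is continuous. -/
lemma threshold_mul_div_le (hΦ : MonotoneOn Φ (Set.Icc 0 1)) (h0 : 0 ≤ Φ 0) :
    threshold α p Φ * p / α ≤ Φ (threshold α p Φ) := by
  set S : Set ℝ := {t ∈ Set.Icc (0 : ℝ) 1 | t * p / α ≤ Φ t} with hS
  have hmem : sSup S ∈ closure S := csSup_mem_closure
    ⟨0, ⟨le_rfl, zero_le_one⟩, by simpa using h0⟩ ⟨1, fun _ hx => hx.1.2⟩
  have hcl : IsClosed {t : ℝ | t * p / α ≤ Φ (threshold α p Φ)} :=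
    isClosed_le (by fun_prop) continuous_const
  have hsub : S ⊆ {t : ℝ | t * p / α ≤ Φ (threshold α p Φ)} := fun t ht =>
    ht.2.trans (hΦ ht.1 (threshold_mem h0) (le_threshold ht.1 ht.2))
  exact closure_minimal hsub hcl hmem

/-- Below `1` the line and the function meet at the threshold. -/
lemma apply_threshold (hΦ : MonotoneOn Φ (Set.Icc 0 1)) (h0 : 0 ≤ Φ 0)
    (h1 : threshold α p Φ < 1)
    (hc : ContinuousWithinAt Φ (Set.Ioo (threshold α p Φ) 1) (threshold α p Φ)) :
    Φ (threshold α p Φ) = threshold α p Φ * p / α := by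
  refine le_antisymm ?_ (threshold_mul_div_le hΦ h0)
  have hne : (𝓝[Set.Ioo (threshold α p Φ) 1] (threshold α p Φ)).NeBot := by
    rw [nhdsWithin_Ioo_eq_nhdsGT h1]; infer_instance
  have hlin : ContinuousWithinAt (fun t => t * p / α) (Set.Ioo (threshold α p Φ) 1)
      (threshold α p Φ) := by fun_prop
  refine le_of_tendsto_of_tendsto hc hlin ?_
  filter_upwards [self_mem_nhdsWithin] with t ht
  exact (lt_of_threshold_lt ((threshold_mem h0).1.trans ht.1.le) ht.2.le ht.1).le

end Threshold

/-! ### The empirical distribution function and its decomposition. -/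

section Empirical

variable {Ω : Type*} {d : ℕ} (X : (Fin d → ℤ) → Ω → ℝ) (N : Fin d → ℕ) (ω : Ω)

lemma monotone_empCdf : Monotone (empCdf X N ω) := fun x y hxy => by
  unfold empCdf
  gcongr with s hs
  by_cases h : X s ω ≤ x
  · simp [h, h.trans hxy]
  · simp only [h, if_false]; split_ifs <;> norm_num

lemma empCdf_nonneg (t : ℝ) : 0 ≤ empCdf X N ω t :=
  div_nonneg (Finset.sum_nonneg fun s _ => by split_ifs <;> norm_num) (Nat.cast_nonneg _)

lemma continuousWithinAt_empCdf (t : ℝ) : ContinuousWithinAt (empCdf X N ω) (Set.Ioi t) t := by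
  unfold empCdf
  refine ContinuousWithinAt.div_const ?_ _
  refine tendsto_finsetSum _ fun s _ => ?_
  by_cases h : X s ω ≤ t
  · refine tendsto_const_nhds.congr' ?_
    filter_upwards [self_mem_nhdsWithin] with y hy
    simp [h, h.trans (le_of_lt hy)]
  · refine tendsto_const_nhds.congr' ?_
    filter_upwards [nhdsWithin_le_nhds (Iio_mem_nhds (not_le.1 h))] with y hy
    simp [h, Set.mem_Iio.1 hy]

/-- The product only guards against `0 / 0`: it vanishes as soon as some p-value is at most `t`. -/
lemma fdProcess_eq (H : (Fin d → ℤ) → Ω → ℝ) {N : Fin d → ℕ} (hN : 0 < cubeSize N) {ω : Ω} {t : ℝ}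
    (h : 0 < empCdf X N ω t) :
    fdProcess H X N ω t = empNull H X N ω t / empCdf X N ω t := by
  have hprod : ∏ s ∈ cube N, (if t < X s ω then (1 : ℝ) else 0) = 0 := by
    by_contra hne
    refine h.ne' ?_
    rw [empCdf, Finset.sum_eq_zero, zero_div]
    intro s hs
    rw [if_neg]
    intro hle
    exact hne (Finset.prod_eq_zero hs (if_neg (not_lt.2 hle)))
  have hn : (cubeSize N : ℝ) ≠ 0 := by positivity
  rw [fdProcess, hprod, add_zero, mul_div_mul_left _ _ hn]

variable (H : (Fin d → ℤ) → Ω → ℝ) (G : ℝ → ℝ)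

lemma empCdf_eq_mixCdf_add (π₀ t : ℝ) :
    empCdf X N ω t = mixCdf π₀ G t + centredCdf H X G N ω t +
      (falseNulls H N ω / cubeSize N - (1 - π₀)) * (G t - t) := by
  rw [centredCdf, mixCdf]; ring

lemma empNull_eq_add (π₀ t : ℝ) :
    empNull H X N ω t = π₀ * t + centredNull H X N ω t -
      (falseNulls H N ω / cubeSize N - (1 - π₀)) * t := by
  rw [centredNull]; ring

end Empirical

/-! ### The population crossing point. -/

section Population

/-- Second order expansion of a function whose derivative is Lipschitz at `a`. -/
lemma exists_quadratic_bound {F f : ℝ → ℝ} {S : Set ℝ} (hS : Convex ℝ S) {a : ℝ} (ha : a ∈ S)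
    (hF : ∀ x ∈ S, HasDerivWithinAt F (f x) S x)
    (hreg : (fun t => f t - f a) =O[𝓝[S] a] fun t => t - a) :
    ∃ c > 0, ∃ η > 0, ∀ t ∈ S, |t - a| ≤ η → |F t - F a - f a * (t - a)| ≤ c * (t - a) ^ 2 := by
  obtain ⟨c, hc, hb⟩ := hreg.exists_pos
  obtain ⟨η, hη, hball⟩ := Metric.mem_nhdsWithin_iff.1 hb.bound
  refine ⟨c, hc, η / 2, by positivity, fun t ht hta => ?_⟩
  set T : Set ℝ := S ∩ Metric.closedBall a |t - a| with hT
  have hconv : Convex ℝ T := hS.inter (convex_closedBall _ _)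
  have hd : ∀ x ∈ T, HasDerivWithinAt (fun x => F x - f a * x) (f x - f a) T x := fun x hx => by
    have h1 := ((hF x hx.1).mono (Set.inter_subset_left : T ⊆ S))
    have h2 : HasDerivWithinAt (fun x => f a * x) (f a) T x := by
      simpa using ((hasDerivAt_id x).const_mul (f a)).hasDerivWithinAt (s := T)
    exact h1.sub h2
  have hbd : ∀ x ∈ T, ‖f x - f a‖ ≤ c * |t - a| := fun x hx => by
    have hx2 : |x - a| ≤ |t - a| := by simpa [Real.dist_eq] using hx.2
    have : ‖f x - f a‖ ≤ c * ‖x - a‖ :=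
      hball ⟨by rw [Metric.mem_ball, Real.dist_eq]; linarith, hx.1⟩
    refine this.trans ?_
    rw [Real.norm_eq_abs]; gcongr
  have := Convex.norm_image_sub_le_of_norm_hasDerivWithin_le hd hbd hconv
    (⟨ha, by simp⟩ : a ∈ T) (⟨ht, by simp [Real.dist_eq]⟩ : t ∈ T)
  rw [Real.norm_eq_abs, Real.norm_eq_abs, mul_assoc, abs_mul_abs_self] at this
  convert this using 2 <;> ring

variable {G g : ℝ → ℝ} {π₀ α : ℝ}

lemma IsAltCdf.hasDerivWithinAt_mixCdf (hG : IsAltCdf G g) {x : ℝ} (hx : x ∈ Set.Icc (0 : ℝ) 1) :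
    HasDerivWithinAt (mixCdf π₀ G) (mixDens π₀ g x) (Set.Icc 0 1) x := by
  have h1 : HasDerivWithinAt (fun x => π₀ * x) π₀ (Set.Icc 0 1) x := by
    simpa using ((hasDerivAt_id x).const_mul π₀).hasDerivWithinAt (s := Set.Icc (0 : ℝ) 1)
  exact h1.add ((hG.deriv x hx).const_mul (1 - π₀))

lemma IsAltCdf.monotoneOn_mixCdf (hG : IsAltCdf G g) (h0 : 0 ≤ π₀) (h1 : π₀ ≤ 1) :
    MonotoneOn (mixCdf π₀ G) (Set.Icc 0 1) := fun x hx y hy hxy => by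
  have := hG.mono hx hy hxy
  unfold mixCdf
  have : 0 ≤ 1 - π₀ := by linarith
  gcongr

lemma IsAltCdf.mixCdf_zero (hG : IsAltCdf G g) : mixCdf π₀ G 0 = 0 := by simp [mixCdf, hG.zero]

lemma IsAltCdf.mixCdf_one (hG : IsAltCdf G g) : mixCdf π₀ G 1 = 1 := by simp [mixCdf, hG.one]

lemma IsAltCdf.continuousOn_mixCdf (hG : IsAltCdf G g) :
    ContinuousOn (mixCdf π₀ G) (Set.Icc 0 1) :=
  fun _ hx => hG.hasDerivWithinAt_mixCdf hx |>.continuousWithinAt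

/-- The condition on `alphaStar` says that `F` starts at `0` with slope above `π₀ / α`, so it is
above the line at some positive point. -/
lemma IsAltCdf.threshold_pos (hG : IsAltCdf G g) (hα : 0 < α) (h0 : 0 < π₀) (h1 : π₀ ≤ 1)
    (hαs : alphaStar π₀ g < α / π₀) : 0 < threshold α π₀ (mixCdf π₀ G) := by
  have m0 : (0 : ℝ) ∈ Set.Icc (0 : ℝ) 1 := ⟨le_rfl, zero_le_one⟩
  have hf0 : 0 < mixDens π₀ g 0 := by
    have := mul_nonneg (sub_nonneg.2 h1) (hG.density_nonneg m0)
    unfold mixDens; linarith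
  have hslope : π₀ / α < mixDens π₀ g 0 := by
    rw [alphaStar, div_lt_div_iff₀ hf0 h0] at hαs
    rw [div_lt_iff₀ hα]; linarith
  have hd := hasDerivWithinAt_iff_tendsto_slope.1
    (hG.hasDerivWithinAt_mixCdf (π₀ := π₀) m0)
  have hset : Set.Icc (0 : ℝ) 1 \ {0} = Set.Ioc 0 1 := Set.Icc_sdiff_left
  rw [hset] at hd
  have hne : (𝓝[Set.Ioc (0 : ℝ) 1] 0).NeBot := by
    rw [nhdsWithin_Ioc_eq_nhdsGT zero_lt_one]; infer_instance
  obtain ⟨t, ht, ht'⟩ := ((hd.eventually (lt_mem_nhds hslope)).and self_mem_nhdsWithin).exists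
  rw [slope_def_field, hG.mixCdf_zero, sub_zero, sub_zero, lt_div_iff₀ ht'.1] at ht
  refine ht'.1.trans_le (le_threshold ⟨ht'.1.le, ht'.2⟩ ?_)
  rw [mul_div_assoc, mul_comm]; exact ht.le

/-- At `1` the line has height `π₀ / α > 1 = F 1`. -/
lemma IsAltCdf.threshold_lt_one (hG : IsAltCdf G g) (hα : 0 < α) (hαπ₀ : α < π₀) (h1 : π₀ ≤ 1) :
    threshold α π₀ (mixCdf π₀ G) < 1 := by
  have hz : 0 ≤ mixCdf π₀ G 0 := hG.mixCdf_zero.ge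
  refine lt_of_le_of_ne (threshold_mem hz).2 fun h => ?_
  have := threshold_mul_div_le (α := α) (p := π₀) (hG.monotoneOn_mixCdf (by linarith) h1) hz
  rw [h, hG.mixCdf_one, one_mul, div_le_one hα] at this
  linarith

lemma IsAltCdf.mixCdf_threshold (hG : IsAltCdf G g) (hα : 0 < α) (hαπ₀ : α < π₀) (h1 : π₀ ≤ 1) :
    mixCdf π₀ G (threshold α π₀ (mixCdf π₀ G)) = threshold α π₀ (mixCdf π₀ G) * π₀ / α := by
  have hz : 0 ≤ mixCdf π₀ G 0 := hG.mixCdf_zero.ge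
  have hm := threshold_mem (α := α) (p := π₀) hz
  exact apply_threshold (hG.monotoneOn_mixCdf (by linarith) h1) hz (hG.threshold_lt_one hα hαπ₀ h1)
    ((hG.continuousOn_mixCdf _ hm).mono fun x hx => ⟨hm.1.trans hx.1.le, hx.2.le⟩)

/-- A function that crosses a line for the last time, transversally, moves away from the line at
least linearly. -/
lemma exists_linear_gap {F : ℝ → ℝ} {ν q s c η : ℝ} (hν : ν ∈ Set.Icc (0 : ℝ) 1)
    (hF : ContinuousOn F (Set.Icc 0 1)) (hν1 : F ν = ν * q)
    (hlt : ∀ t, ν < t → t ≤ 1 → F t < t * q) (hs : s < q) (hη : 0 < η) (hc : 0 < c)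
    (hquad : ∀ t ∈ Set.Icc (0 : ℝ) 1, |t - ν| ≤ η → |F t - F ν - s * (t - ν)| ≤ c * (t - ν) ^ 2) :
    ∃ κ > 0, ∃ η' > 0, (∀ t, ν ≤ t → t ≤ 1 → F t ≤ t * q - κ * (t - ν)) ∧
      ∀ t, 0 ≤ t → t ≤ ν → ν - η' ≤ t → t * q + κ * (ν - t) ≤ F t := by
  -- Within `η'` of `ν` the quadratic error consumes at most half of the slope difference `q - s`.
  -- Farther to the right, compactness gives a positive gap `m`, which is at least `m * (t - ν)`
  -- since `t - ν ≤ 1`.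
  set η' := min η ((q - s) / (2 * c)) with hη'
  have hη'0 : 0 < η' := lt_min hη (div_pos (by linarith) (by linarith))
  have hη'1 : η' ≤ η := min_le_left _ _
  have hη'2 : c * η' ≤ (q - s) / 2 := by
    have := min_le_right η ((q - s) / (2 * c))
    rw [← hη', le_div_iff₀ (by linarith)] at this
    linarith
  obtain ⟨m, hm0, hm⟩ : ∃ m > 0, ∀ t ∈ Set.Icc (ν + η') 1, m ≤ t * q - F t := by
    rcases (Set.Icc (ν + η') 1).eq_empty_or_nonempty with h | h
    · exact ⟨1, one_pos, by simp [h]⟩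
    · have hcont : ContinuousOn (fun t => t * q - F t) (Set.Icc (ν + η') 1) :=
        ContinuousOn.sub (by fun_prop)
          (hF.mono (Set.Icc_subset_Icc_left (by linarith [hν.1])))
      obtain ⟨x, hx, hmin⟩ := isCompact_Icc.exists_isMinOn h hcont
      exact ⟨x * q - F x, sub_pos.2 (hlt x (by linarith [hx.1]) hx.2), fun t ht => hmin ht⟩
  refine ⟨min ((q - s) / 2) m, lt_min (by linarith) hm0, η', hη'0, fun t ht1 ht2 => ?_,
    fun t ht0 ht1 ht2 => ?_⟩
  · have hk1 := min_le_left ((q - s) / 2) m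
    have hk2 := min_le_right ((q - s) / 2) m
    have hu : 0 ≤ t - ν := by linarith
    rcases le_total t (ν + η') with h | h
    · have h1 := (abs_le.1 (hquad t ⟨hν.1.trans ht1, ht2⟩
        (by rw [abs_of_nonneg hu]; linarith))).2
      have h2 : c * (t - ν) ^ 2 ≤ (q - s) / 2 * (t - ν) := by
        have : c * (t - ν) ≤ c * η' := by gcongr; linarith
        nlinarith
      have h3 : min ((q - s) / 2) m * (t - ν) ≤ (q - s) / 2 * (t - ν) := by gcongr
      nlinarith
    · have h1 := hm t ⟨h, ht2⟩
      have h2 : min ((q - s) / 2) m * (t - ν) ≤ m * 1 := by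
        gcongr
        linarith [hν.1]
      linarith
  · have hk1 := min_le_left ((q - s) / 2) m
    have hu : 0 ≤ ν - t := by linarith
    have h1 := (abs_le.1 (hquad t ⟨ht0, ht1.trans hν.2⟩
        (by rw [abs_sub_comm, abs_of_nonneg hu]; linarith))).1
    have h2 : c * (t - ν) ^ 2 ≤ (q - s) / 2 * (ν - t) := by
      have : c * (ν - t) ≤ c * η' := by gcongr; linarith
      nlinarith
    have h3 : min ((q - s) / 2) m * (ν - t) ≤ (q - s) / 2 * (ν - t) := by gcongr
    nlinarith

end Population

/-! ### Powers of the sample size. -/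

section Rates

lemma rpow_rates {n : ℕ} (hn : 0 < n) :
    0 < (n : ℝ) ^ (-(1 / 3) : ℝ) ∧ 0 < (n : ℝ) ^ (-(1 / 2) : ℝ) ∧
    (n : ℝ) ^ (-(1 / 2) : ℝ) ≤ (n : ℝ) ^ (-(1 / 3) : ℝ) ∧
    (n : ℝ) ^ (-(2 / 3) : ℝ) ≤ (n : ℝ) ^ (-(1 / 2) : ℝ) ∧
    √(n : ℝ) / n = (n : ℝ) ^ (-(1 / 2) : ℝ) ∧
    (n : ℝ) ^ (-(2 / 3) : ℝ) = ((n : ℝ) ^ (-(1 / 3) : ℝ)) ^ 2 ∧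
    ∀ c : ℝ, 0 ≤ c →
      √(n * (c * (n : ℝ) ^ (-(1 / 3) : ℝ))) / n = √c * (n : ℝ) ^ (-(2 / 3) : ℝ) := by
  have h0 : (0 : ℝ) < n := by exact_mod_cast hn
  have h1 : (1 : ℝ) ≤ n := by exact_mod_cast hn
  refine ⟨by positivity, by positivity, Real.rpow_le_rpow_of_exponent_le h1 (by norm_num),
    Real.rpow_le_rpow_of_exponent_le h1 (by norm_num), ?_, ?_, fun c hc => ?_⟩
  · rw [Real.sqrt_eq_rpow, div_eq_iff h0.ne']
    nth_rewrite 3 [← Real.rpow_one (n : ℝ)]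
    rw [← Real.rpow_add h0]; norm_num
  · rw [← Real.rpow_natCast, ← Real.rpow_mul h0.le]; norm_num
  · have h2 : (n : ℝ) * (c * (n : ℝ) ^ (-(1 / 3) : ℝ)) = c * (n : ℝ) ^ (2 / 3 : ℝ) := by
      have : (n : ℝ) * (n : ℝ) ^ (-(1 / 3) : ℝ) = (n : ℝ) ^ (2 / 3 : ℝ) := by
        nth_rewrite 1 [← Real.rpow_one (n : ℝ)]
        rw [← Real.rpow_add h0]; norm_num
      rw [← this]; ring
    rw [h2, Real.sqrt_mul hc, Real.sqrt_eq_rpow ((n : ℝ) ^ (2 / 3 : ℝ)), ← Real.rpow_mul h0.le,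
      div_eq_iff h0.ne', mul_assoc]
    nth_rewrite 3 [← Real.rpow_one (n : ℝ)]
    rw [← Real.rpow_add h0]; norm_num

lemma tendsto_natCast_rpow_neg {p : ℝ} (hp : 0 < p) :
    Tendsto (fun n : ℕ => (n : ℝ) ^ (-p)) atTop (𝓝 0) :=
  (tendsto_rpow_neg_atTop hp).comp tendsto_natCast_atTop_atTop

lemma tendsto_natCast_mul_rpow (c : ℝ) (hc : 0 < c) :
    Tendsto (fun n : ℕ => (n : ℝ) * (c * (n : ℝ) ^ (-(1 / 3) : ℝ))) atTop atTop := by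
  have h : Tendsto (fun n : ℕ => c * (n : ℝ) ^ (2 / 3 : ℝ)) atTop atTop :=
    ((tendsto_rpow_atTop (by norm_num)).comp tendsto_natCast_atTop_atTop).const_mul_atTop hc
  refine h.congr' ?_
  filter_upwards [eventually_gt_atTop 0] with n hn
  have h0 : (0 : ℝ) < n := by exact_mod_cast hn
  have : (n : ℝ) * (n : ℝ) ^ (-(1 / 3) : ℝ) = (n : ℝ) ^ (2 / 3 : ℝ) := by
    nth_rewrite 1 [← Real.rpow_one (n : ℝ)]
    rw [← Real.rpow_add h0]; norm_num
  rw [← this]; ring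

end Rates

/-! ### Events of high probability on which all error terms are small. -/

section GoodEvents

variable {Ω : Type*} [MeasurableSpace Ω] {μ : Measure Ω} [IsProbabilityMeasure μ] {d : ℕ}
  {H U X : (Fin d → ℤ) → Ω → ℝ} {G g : ℝ → ℝ}

/-- The processes that enter the expansions are small off an event of small probability. -/
lemma exists_good_event (hd : 0 < d) (hH : Condition1 μ H) (hU : IsUniformNoise μ H U)
    (hG : IsAltCdf G g)
    (hX : ∀ s ω, X s ω = (1 - H s ω) * U s ω + H s ω * quantile G (U s ω))
    {b : ℕ → ℝ} {c₁ c₂ : ℝ} (hc₁ : 0 < c₁) (hb : ∀ᶠ n in atTop, b n ∈ Set.Ioo (0 : ℝ) 1)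
    (hb₁ : ∀ᶠ n : ℕ in atTop, c₁ * (n : ℝ) ^ (-(1 / 3) : ℝ) ≤ b n)
    (hb₂ : ∀ᶠ n : ℕ in atTop, b n ≤ c₂ * (n : ℝ) ^ (-(1 / 3) : ℝ)) {ε : ℝ} (hε : 0 < ε) :
    ∃ M : ℝ, 0 < M ∧ ∀ᶠ N : Fin d → ℕ in atTop, ∃ B : Set Ω, μ.real B ≤ ε ∧ ∀ ω ∉ B,
      |falseNulls H N ω / cubeSize N - (1 - nullProp μ H)|
        ≤ M * (cubeSize N : ℝ) ^ (-(1 / 2) : ℝ) ∧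
      (∀ t ∈ Set.Icc (0 : ℝ) 1, |centredCdf H X G N ω t|
        ≤ M * (cubeSize N : ℝ) ^ (-(1 / 2) : ℝ)) ∧
      |centredCdf H X G N ω (1 - b (cubeSize N))| ≤ M * (cubeSize N : ℝ) ^ (-(2 / 3) : ℝ) ∧
      ∀ t ∈ Set.Icc (0 : ℝ) 1, |centredNull H X N ω t|
        ≤ M * (cubeSize N : ℝ) ^ (-(1 / 2) : ℝ) := by
  have hε3 : 0 < ε / 4 := by positivity
  obtain ⟨M₁, hM₁, h₁⟩ := exists_falseNulls_bound hd hH hε3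
  obtain ⟨M₂, hM₂, h₂⟩ := exists_centredCdf_bound hH.measurable hH.zero_or_one hU hG hX hε3
  obtain ⟨M₃, hM₃, h₃⟩ := exists_centredNull_bound hH.measurable hH.zero_or_one hU hX hε3
  have hcs := tendsto_cubeSize hd
  refine ⟨M₁ + M₂ + M₂ * √c₂ + M₃, by positivity, ?_⟩
  filter_upwards [h₁, hcs.eventually_gt_atTop 0, hcs.eventually hb, hcs.eventually hb₁,
    hcs.eventually hb₂, hcs.eventually
      ((tendsto_natCast_mul_rpow c₁ hc₁).eventually_ge_atTop 1)] with N h₁ hN hb hb₁ hb₂ hnc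
  set n := cubeSize N with hn
  have hn1 : (1 : ℝ) ≤ n := by exact_mod_cast hN
  obtain ⟨hρ, hδ, hδρ, hρδ, hsq, hρ2, hwin⟩ := rpow_rates hN
  have hnb : 1 ≤ (n : ℝ) * b n := hnc.trans (by gcongr)
  have hc₂ : 0 ≤ c₂ := by
    by_contra h
    have := mul_neg_of_neg_of_pos (not_le.1 h) hρ
    linarith [hb.1]
  obtain ⟨B₁, hB₁, h₁⟩ := h₁
  obtain ⟨B₂, hB₂, h₂a⟩ := h₂ N 0 1 le_rfl zero_le_one (by norm_num) (by simpa using hn1)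
  -- The window `[1 - b n, 1]` ends where the process vanishes, so its oscillation bounds the value
  -- at `1 - b n` by order `n ^ (-2/3)`, better than the global `n ^ (-1/2)`.
  obtain ⟨B₃, hB₃, h₂b⟩ := h₂ N (1 - b n) (b n) (by linarith [hb.2]) hb.1.le (by simp) hnb
  obtain ⟨B₄, hB₄, h₃⟩ := h₃ N hN
  refine ⟨B₁ ∪ B₂ ∪ B₃ ∪ B₄, ?_, fun ω hω => ?_⟩
  · have e1 := measureReal_union_le (μ := μ) (B₁ ∪ B₂ ∪ B₃) B₄
    have e2 := measureReal_union_le (μ := μ) (B₁ ∪ B₂) B₃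
    have e3 := measureReal_union_le (μ := μ) B₁ B₂
    linarith
  · simp only [Set.mem_union, not_or] at hω
    obtain ⟨⟨⟨w₁, w₂⟩, w₃⟩, w₄⟩ := hω
    have hM : 0 ≤ M₂ * √c₂ := by positivity
    refine ⟨?_, fun t ht => ?_, ?_, fun t ht => ?_⟩
    · refine (h₁ ω w₁).trans ?_
      rw [hsq]; gcongr; linarith
    · obtain ⟨z0, -, hz⟩ := h₂a ω w₂
      have := hz t (by simpa using ht)
      rw [z0, sub_zero, mul_one, hsq] at this
      refine this.trans ?_
      gcongr; linarith
    · obtain ⟨-, z1, hz⟩ := h₂b ω w₃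
      have := hz 1 (by simp [hb.1.le])
      rw [z1, zero_sub, abs_neg] at this
      refine this.trans ?_
      calc M₂ * (√(n * b n) / n)
          ≤ M₂ * (√(n * (c₂ * (n : ℝ) ^ (-(1 / 3) : ℝ))) / n) := by gcongr
        _ = M₂ * √c₂ * (n : ℝ) ^ (-(2 / 3) : ℝ) := by rw [hwin c₂ hc₂]; ring
        _ ≤ _ := by gcongr; linarith
    · refine (h₃ ω w₄ t ht).trans ?_
      rw [hsq]; gcongr; linarith

/-- The oscillation of the centred empirical distribution function in a window of width
`n ^ (-1/3)` is of order `n ^ (-2/3)`. -/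
lemma exists_good_window (hd : 0 < d) (hH : Condition1 μ H) (hU : IsUniformNoise μ H U)
    (hG : IsAltCdf G g)
    (hX : ∀ s ω, X s ω = (1 - H s ω) * U s ω + H s ω * quantile G (U s ω))
    {a L : ℝ} (ha0 : 0 < a) (ha1 : a < 1) (hL : 0 < L) {ε : ℝ} (hε : 0 < ε) :
    ∃ M : ℝ, 0 < M ∧ ∀ᶠ N : Fin d → ℕ in atTop, ∃ B : Set Ω, μ.real B ≤ ε ∧ ∀ ω ∉ B,
      ∀ t, |t - a| ≤ L * (cubeSize N : ℝ) ^ (-(1 / 3) : ℝ) →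
        |centredCdf H X G N ω t - centredCdf H X G N ω a|
          ≤ M * (cubeSize N : ℝ) ^ (-(2 / 3) : ℝ) := by
  obtain ⟨M, hM, h⟩ := exists_centredCdf_bound hH.measurable hH.zero_or_one hU hG hX hε
  have hcs := tendsto_cubeSize hd
  refine ⟨2 * (M * √(2 * L)), by positivity, ?_⟩
  have hlim : Tendsto (fun n : ℕ => L * (n : ℝ) ^ (-(1 / 3) : ℝ)) atTop (𝓝 0) := by
    simpa using (tendsto_natCast_rpow_neg (by norm_num : (0 : ℝ) < 1 / 3)).const_mul L
  filter_upwards [hcs.eventually_gt_atTop 0, hcs.eventually (hlim.eventually_lt_const ha0),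
    hcs.eventually (hlim.eventually_lt_const (sub_pos.2 ha1)), hcs.eventually
      ((tendsto_natCast_mul_rpow (2 * L) (by positivity)).eventually_ge_atTop 1)]
    with N hN h1 h2 h3
  obtain ⟨hρ, -, -, -, -, -, hwin⟩ := rpow_rates hN
  set r := L * (cubeSize N : ℝ) ^ (-(1 / 3) : ℝ) with hr
  have hr0 : 0 < r := by positivity
  have h2r : 2 * L * (cubeSize N : ℝ) ^ (-(1 / 3) : ℝ) = 2 * r := by rw [hr]; ring
  -- The oscillation bound is anchored at the left end of a window, so `t` and `a` are both compared
  -- with `a - r`; this doubles the constant.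
  obtain ⟨B, hB, hosc⟩ := h N (a - r) (2 * r) (by linarith) (by linarith) (by linarith)
    (h2r ▸ h3)
  refine ⟨B, hB, fun ω hω t ht => ?_⟩
  obtain ⟨-, -, hosc⟩ := hosc ω hω
  have hw := hwin (2 * L) (by positivity)
  rw [h2r] at hw
  rw [hw] at hosc
  rw [abs_le] at ht
  have e1 := hosc t ⟨by linarith, by linarith⟩
  have e2 := hosc a ⟨by linarith, by linarith⟩
  have e3 := abs_sub_le (centredCdf H X G N ω t) (centredCdf H X G N ω (a - r))
    (centredCdf H X G N ω a)
  rw [abs_sub_comm (centredCdf H X G N ω (a - r))] at e3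
  linarith

end GoodEvents

/-! ### Deterministic expansions on the good event. -/

section Expansions

/-- Three errors are divided by `b`, which is of order `ρ`: the bias `c * b ^ 2`, the noise `D` of
order `ρ ^ 2`, and `e * y`, where `y` is itself of order `b`. -/
lemma abs_storey_sub_le {π₀ b c c₁ c₂ M K ρ Fb Fn D e y : ℝ} (hρ : 0 < ρ) (hb : 0 < b)
    (hc : 0 ≤ c) (hc₁ : 0 < c₁) (hM : 0 ≤ M) (hb₁ : c₁ * ρ ≤ b) (hb₂ : b ≤ c₂ * ρ)
    (hFb : |1 - Fb - π₀ * b| ≤ c * b ^ 2) (hD : |D| ≤ M * ρ ^ 2) (he : |e| ≤ M * ρ)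
    (hy : |y| ≤ K * b) (hFn : Fn = Fb + D + e * y) :
    |(1 - Fn) / b - π₀| ≤ (c * c₂ + M / c₁ + M * K) * ρ := by
  have h1 : (1 - Fn) / b - π₀ = (1 - Fb - π₀ * b - D - e * y) / b := by
    rw [hFn]; field_simp; ring
  rw [h1, abs_div, abs_of_pos hb, div_le_iff₀ hb]
  have h2 : |1 - Fb - π₀ * b - D - e * y| ≤ c * b ^ 2 + M * ρ ^ 2 + M * ρ * (K * b) := by
    have e1 := abs_sub (1 - Fb - π₀ * b - D) (e * y)
    have e2 := abs_sub (1 - Fb - π₀ * b) D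
    have e3 : |e * y| ≤ M * ρ * (K * b) := by rw [abs_mul]; gcongr
    linarith
  have h3 : c * b ^ 2 ≤ c * c₂ * ρ * b := by
    have : c * b * b ≤ c * b * (c₂ * ρ) := by gcongr
    nlinarith
  have h4 : M * ρ ^ 2 ≤ M / c₁ * ρ * b := by
    have : M / c₁ * ρ * (c₁ * ρ) ≤ M / c₁ * ρ * b := by gcongr
    have e : M / c₁ * ρ * (c₁ * ρ) = M * ρ ^ 2 := by field_simp
    linarith
  nlinarith

/-- Being a supremum, the threshold exceeds `ν - r` once that single point qualifies, but lies below
`ν + r` only if no later point does. So the gap is needed locally on the left and up to `1` on the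
right. -/
lemma abs_threshold_sub_le {α π₀ p ν κ η r E E' : ℝ} {F Φ : ℝ → ℝ} (hα : 0 < α) (hν : ν ≤ 1)
    (hup : ∀ t, ν ≤ t → t ≤ 1 → F t ≤ t * (π₀ / α) - κ * (t - ν))
    (hlow : ∀ t, 0 ≤ t → t ≤ ν → ν - η ≤ t → t * (π₀ / α) + κ * (ν - t) ≤ F t)
    (hΦ : MonotoneOn Φ (Set.Icc 0 1)) (hΦ0 : 0 ≤ Φ 0)
    (hE : ∀ t ∈ Set.Icc (0 : ℝ) 1, |Φ t - F t| ≤ E) (hE' : |p - π₀| ≤ E')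
    (hκ : 0 < κ) (hr : E + E' / α < κ * r) (hr0 : 0 ≤ r) (hrη : r ≤ η) (hrν : r ≤ ν) :
    |threshold α p Φ - ν| ≤ r := by
  have hslope : ∀ t ∈ Set.Icc (0 : ℝ) 1, |t * p / α - t * (π₀ / α)| ≤ E' / α := fun t ht => by
    have : t * p / α - t * (π₀ / α) = t * ((p - π₀) / α) := by ring
    rw [this, abs_mul, abs_div, abs_of_pos hα, abs_of_nonneg ht.1]
    have h1 : |p - π₀| / α ≤ E' / α := by gcongr
    have h2 : 0 ≤ |p - π₀| / α := by positivity
    nlinarith [ht.1, ht.2]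
  rw [abs_le]
  constructor
  · have ht : ν - r ∈ Set.Icc (0 : ℝ) 1 := ⟨by linarith, by linarith⟩
    have h1 := hlow (ν - r) ht.1 (by linarith) (by linarith)
    have h2 := (abs_le.1 (hE _ ht)).1
    have h3 := (abs_le.1 (hslope _ ht)).2
    have := le_threshold (α := α) (p := p) (Φ := Φ) ht (by
      rw [show ν - (ν - r) = r by ring] at h1; linarith)
    linarith
  · by_contra h
    push Not at h
    have ht := threshold_mem (α := α) (p := p) hΦ0
    have h0 := threshold_mul_div_le (α := α) (p := p) hΦ hΦ0
    have h1 := hup _ (by linarith) ht.2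
    have h2 := (abs_le.1 (hE _ ht)).2
    have h3 := (abs_le.1 (hslope _ ht)).1
    have h4 : κ * r ≤ κ * (threshold α p Φ - ν) := by gcongr
    linarith

lemma abs_threshold_expansion_le {α π₀ p s ν ν' Fn Fn' F F' D D' e y y' c L K M M' ρ : ℝ}
    (hα : 0 < α) (hs : 0 < π₀ / α - s) (hF : F = ν * π₀ / α) (hFn' : Fn' = ν' * p / α)
    (hFn : Fn = F + D + e * y) (hFn'' : Fn' = F' + D' + e * y') (hD : |D' - D| ≤ M' * ρ ^ 2)
    (hquad : |F' - F - s * (ν' - ν)| ≤ c * (ν' - ν) ^ 2) (hy : |y' - y| ≤ K * |ν' - ν|)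
    (he : |e| ≤ M * ρ) (hν : |ν' - ν| ≤ L * ρ) (hp : |p - π₀| ≤ L * ρ) (hc : 0 ≤ c) (hK : 0 ≤ K)
    (hM : 0 ≤ M) (hρ : 0 ≤ ρ) (hL : 0 ≤ L) :
    |(ν' - ν) - (ν * (π₀ - p) / (π₀ - α * s) + (Fn - F) / (π₀ / α - s))|
      ≤ (M' + M * K * L + c * L ^ 2 + L ^ 2 / α) / (π₀ / α - s) * ρ ^ 2 := by
  have hden : π₀ - α * s = α * (π₀ / α - s) := by field_simp
  -- Subtracting the crossing equations makes the remainder exact: an oscillation, two increments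
  -- over the window, and the product of the two estimation errors, all of order `ρ ^ 2`.
  have key : (ν' - ν) - (ν * (π₀ - p) / (π₀ - α * s) + (Fn - F) / (π₀ / α - s))
      = ((D' - D) + e * (y' - y) + (F' - F - s * (ν' - ν)) - (ν' - ν) * (p - π₀) / α)
        / (π₀ / α - s) := by
    have h1 : (D' - D) + e * (y' - y) + (F' - F - s * (ν' - ν)) - (ν' - ν) * (p - π₀) / α
        = (π₀ / α - s) * (ν' - ν) - ν * (π₀ - p) / α - (Fn - F) := by
      have : (D' - D) + e * (y' - y) + (F' - F) = Fn' - Fn := by rw [hFn'', hFn]; ring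
      calc _ = (Fn' - Fn) - s * (ν' - ν) - (ν' - ν) * (p - π₀) / α := by rw [← this]; ring
        _ = _ := by rw [hFn', hF]; ring
    rw [h1, hden]
    have := hs.ne'
    generalize π₀ / α - s = z at this
    field_simp
    ring
  rw [key, abs_div, abs_of_pos hs, div_mul_eq_mul_div]
  gcongr
  have e1 : |e * (y' - y)| ≤ M * ρ * (K * (L * ρ)) := by
    rw [abs_mul]
    gcongr
    exact hy.trans (by gcongr)
  have e2 : c * (ν' - ν) ^ 2 ≤ c * (L * ρ) ^ 2 := by
    rw [← sq_abs (ν' - ν)]; gcongr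
  have e3 : |(ν' - ν) * (p - π₀) / α| ≤ L * ρ * (L * ρ) / α := by
    rw [abs_div, abs_mul, abs_of_pos hα]; gcongr
  have t1 := abs_sub ((D' - D) + e * (y' - y) + (F' - F - s * (ν' - ν))) ((ν' - ν) * (p - π₀) / α)
  have t2 := abs_add_le ((D' - D) + e * (y' - y)) (F' - F - s * (ν' - ν))
  have t3 := abs_add_le (D' - D) (e * (y' - y))
  calc _ ≤ M' * ρ ^ 2 + M * ρ * (K * (L * ρ)) + c * (L * ρ) ^ 2 + L * ρ * (L * ρ) / α := by
        linarith
    _ = _ := by ring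

lemma abs_fdp_expansion_le {α π₀ p ν₀ ν D e L M δ ρ : ℝ} (hα : 0 < α) (hπ₀ : 0 < π₀)
    (hν₀ : 0 < ν₀) (hν : ν₀ / 2 ≤ ν) (hν1 : ν ≤ 1) (hp : π₀ / 2 ≤ p) (hD : |D| ≤ M * δ)
    (he : |e| ≤ M * δ) (hpL : |p - π₀| ≤ L * ρ) (hρ : ρ ^ 2 ≤ δ) :
    |((π₀ * ν + D - e * ν) / (ν * p / α) - α) - α * (1 - p / π₀)|
      ≤ (8 * α * M / (ν₀ * π₀) + 2 * α * L ^ 2 / π₀ ^ 2) * δ := by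
  have hνpos : 0 < ν := by linarith
  have hppos : 0 < p := by linarith
  -- Without noise the ratio is `α * π₀ / p`, whose linearization at `p = π₀` has the exact error `α
  -- * (p - π₀) ^ 2 / (π₀ * p)`.
  have key : ((π₀ * ν + D - e * ν) / (ν * p / α) - α) - α * (1 - p / π₀)
      = α * (D - e * ν) / (ν * p) + α * (p - π₀) ^ 2 / (π₀ * p) := by
    field_simp; ring
  rw [key]
  have hMδ : 0 ≤ M * δ := (abs_nonneg _).trans hD
  have h1 : |α * (D - e * ν) / (ν * p)| ≤ α * (2 * (M * δ)) / (ν₀ / 2 * (π₀ / 2)) := by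
    rw [abs_div, abs_mul, abs_of_pos hα, abs_of_pos (mul_pos hνpos hppos)]
    gcongr
    have e1 : |e * ν| ≤ M * δ := by
      rw [abs_mul, abs_of_pos hνpos]
      nlinarith [abs_nonneg e]
    linarith [abs_sub D (e * ν)]
  have hsq : (p - π₀) ^ 2 ≤ L ^ 2 * δ := by
    calc (p - π₀) ^ 2 = |p - π₀| ^ 2 := (sq_abs _).symm
      _ ≤ (L * ρ) ^ 2 := by gcongr
      _ = L ^ 2 * ρ ^ 2 := by ring
      _ ≤ L ^ 2 * δ := by gcongr
  have h2 : |α * (p - π₀) ^ 2 / (π₀ * p)| ≤ α * (L ^ 2 * δ) / (π₀ * (π₀ / 2)) := by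
    rw [abs_of_nonneg (by positivity)]
    have : 0 ≤ L ^ 2 * δ := (sq_nonneg _).trans hsq
    exact div_le_div₀ (by positivity) (by gcongr) (by positivity) (by gcongr)
  refine (abs_add_le _ _).trans ((add_le_add h1 h2).trans_eq ?_)
  field_simp
  ring

end Expansions

/-- Neither `Y` nor `B` has to be measurable, since `μ.real` is monotone on arbitrary sets;
measurability of the random threshold therefore never enters. -/
lemma isBigOP_of_eventually {Ω ι : Type*} [MeasurableSpace Ω] {μ : Measure Ω} [IsFiniteMeasure μ]
    {l : Filter ι} {Y : ι → Ω → ℝ} {r : ι → ℝ}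
    (h : ∀ ε > 0, ∃ M : ℝ, ∀ᶠ i in l, ∃ B : Set Ω, μ.real B ≤ ε ∧ ∀ ω ∉ B, |Y i ω| ≤ M * r i) :
    IsBigOP μ l Y r := fun ε hε => by
  obtain ⟨M, hM⟩ := h ε hε
  refine ⟨M, hM.mono fun i ⟨B, hB, hY⟩ => (measureReal_mono fun ω hω => ?_).trans hB⟩
  by_contra hn
  exact absurd (hY ω hn) (not_le.2 hω)

lemma IsSlowCdf.abs_sub_sub_le {G : ℝ → ℝ} {K x y : ℝ} (hG : IsSlowCdf K G) (hK : 1 ≤ K)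
    (hx : 0 ≤ x) (hxy : x ≤ y) (hy : y ≤ 1) : |(G y - y) - (G x - x)| ≤ K * (y - x) := by
  obtain ⟨_, h1, _, h2⟩ := hG x y hx hxy hy
  rw [abs_le]
  constructor <;> nlinarith

lemma IsSlowCdf.abs_sub_self_le {G : ℝ → ℝ} {K t : ℝ} (hG : IsSlowCdf K G)
    (ht : t ∈ Set.Icc (0 : ℝ) 1) : |G t - t| ≤ 1 := by
  obtain ⟨h1, _, h2, _⟩ := hG t t ht.1 le_rfl ht.2
  rw [abs_le]
  constructor <;> linarith [ht.1, ht.2]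

lemma exists_pos_bounds_of_isTheta {ι : Type*} {l : Filter ι} {b r : ι → ℝ}
    (h : b =Θ[l] r) (hb : ∀ᶠ i in l, 0 ≤ b i) (hr : ∀ i, 0 ≤ r i) :
    ∃ c₁ > 0, ∃ c₂ > 0, (∀ᶠ i in l, c₁ * r i ≤ b i) ∧ ∀ᶠ i in l, b i ≤ c₂ * r i := by
  obtain ⟨c₂, hc₂, hb₂⟩ := h.1.exists_pos
  obtain ⟨c₁, hc₁, hb₁⟩ := h.2.exists_pos
  refine ⟨c₁⁻¹, by positivity, c₂, hc₂, ?_, ?_⟩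
  · filter_upwards [hb₁.bound, hb] with i h1 h2
    rw [Real.norm_of_nonneg (hr i), Real.norm_of_nonneg h2] at h1
    rwa [inv_mul_le_iff₀ hc₁]
  · filter_upwards [hb₂.bound, hb] with i h1 h2
    rwa [Real.norm_of_nonneg h2, Real.norm_of_nonneg (hr i)] at h1

lemma abs_empCdf_sub_mixCdf_le {Ω : Type*} {d : ℕ} (X H : (Fin d → ℤ) → Ω → ℝ) (G : ℝ → ℝ)
    (N : Fin d → ℕ) (ω : Ω) {π₀ t m : ℝ} (hGt : |G t - t| ≤ 1)
    (he : |falseNulls H N ω / cubeSize N - (1 - π₀)| ≤ m) (hD : |centredCdf H X G N ω t| ≤ m) :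
    |empCdf X N ω t - mixCdf π₀ G t| ≤ 2 * m := by
  rw [empCdf_eq_mixCdf_add X N ω H G π₀, add_assoc, add_sub_cancel_left]
  refine (abs_add_le _ _).trans ?_
  rw [abs_mul]
  have := mul_le_of_le_one_right (abs_nonneg (falseNulls H N ω / cubeSize N - (1 - π₀))) hGt
  linarith

end FDR

/-! ### Assembly of the two expansions. -/

theorem theorem4 {Ω : Type*} [MeasurableSpace Ω] (μ : Measure Ω) [IsProbabilityMeasure μ]
    {d : ℕ} (hd : 0 < d) (H U X : (Fin d → ℤ) → Ω → ℝ) (G g : ℝ → ℝ)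
    -- the conditional independence model
    (hH : FDR.Condition1 μ H)
    (hU : FDR.IsUniformNoise μ H U)
    (hG : FDR.IsAltCdf G g)
    (hX : ∀ s ω, X s ω = (1 - H s ω) * U s ω + H s ω * FDR.quantile G (U s ω))
    -- the null proportion, the marginal distribution of the p-values, the level, the threshold
    (π₀ : ℝ) (hπ₀ : π₀ = FDR.nullProp μ H)
    (F f : ℝ → ℝ) (hF : F = FDR.mixCdf π₀ G) (hf : f = FDR.mixDens π₀ g)
    (α : ℝ) (hα : 0 < α) (hαπ₀ : α < π₀)
    (νs : ℝ) (hνs : νs = FDR.threshold α π₀ F)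
    (hg1 : g 1 = 0)
    (hαs : FDR.alphaStar π₀ g < α / π₀)
    (hfν : f νs < π₀ / α)
    -- local regularity of the density
    (hregν : (fun t => f t - f νs) =O[𝓝[Set.Icc 0 1] νs] fun t => t - νs)
    (hreg1 : (fun t => f t - f 1) =O[𝓝[Set.Icc 0 1] 1] fun t => t - 1)
    -- the bandwidth
    (b : ℕ → ℝ) (hb : ∀ᶠ n in atTop, b n ∈ Set.Ioo (0 : ℝ) 1)
    (hbn : b =Θ[atTop] fun n : ℕ => (n : ℝ) ^ (-(1 / 3) : ℝ))
    -- Storey's estimator and the plug-in threshold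
    (πhat νPI : (Fin d → ℕ) → Ω → ℝ)
    (hπhat : ∀ N ω, πhat N ω = FDR.storey X (b (FDR.cubeSize N)) N ω)
    (hνPI : ∀ N ω, νPI N ω = FDR.threshold α (πhat N ω) (FDR.empCdf X N ω)) :
    FDR.IsBigOP μ (atTop : Filter (Fin d → ℕ))
      (fun N ω => (νPI N ω - νs) -
        (νs * (π₀ - πhat N ω) / (π₀ - α * f νs) +
          (FDR.empCdf X N ω νs - F νs) / (π₀ / α - f νs)))
      (fun N => (FDR.cubeSize N : ℝ) ^ (-(2 / 3) : ℝ)) ∧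
    FDR.IsBigOP μ (atTop : Filter (Fin d → ℕ))
      (fun N ω => (FDR.fdProcess H X N ω (νPI N ω) - α) - α * (1 - πhat N ω / π₀))
      (fun N => (FDR.cubeSize N : ℝ) ^ (-(1 / 2) : ℝ)) := by
  subst hπ₀ hF hf
  set π₀ := FDR.nullProp μ H with hπ₀def
  have hπ₀ : 0 < π₀ := hα.trans hαπ₀
  have hπ₀1 : π₀ ≤ 1 := measureReal_le_one
  have hν0 : 0 < νs := hνs ▸ hG.threshold_pos hα hπ₀ hπ₀1 hαs
  have hν1 : νs < 1 := hνs ▸ hG.threshold_lt_one hα hαπ₀ hπ₀1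
  have hFν : FDR.mixCdf π₀ G νs = νs * π₀ / α := by
    rw [hνs]; exact hG.mixCdf_threshold hα hαπ₀ hπ₀1
  have mν : νs ∈ Set.Icc (0 : ℝ) 1 := ⟨hν0.le, hν1.le⟩
  have m1 : (1 : ℝ) ∈ Set.Icc (0 : ℝ) 1 := ⟨zero_le_one, le_rfl⟩
  obtain ⟨c, hc, η, hη, hquad⟩ := FDR.exists_quadratic_bound (convex_Icc 0 1) mν
    (fun x hx => hG.hasDerivWithinAt_mixCdf hx) hregν
  obtain ⟨c', hc', η₁, hη₁, hquad₁⟩ := FDR.exists_quadratic_bound (convex_Icc 0 1) m1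
    (fun x hx => hG.hasDerivWithinAt_mixCdf hx) hreg1
  obtain ⟨κ, hκ, η', hη', hup, hlow⟩ := FDR.exists_linear_gap (q := π₀ / α) mν
    hG.continuousOn_mixCdf (by rw [hFν, mul_div_assoc])
    (fun t ht1 ht2 => by
      rw [← mul_div_assoc]
      exact FDR.lt_of_threshold_lt (hν0.le.trans ht1.le) ht2 (hνs ▸ ht1)) hfν hη hc hquad
  obtain ⟨K, hK, hGK⟩ := hG.exists_isSlowCdf
  have hGdist := fun x y => hGK.abs_sub_sub_le (x := x) (y := y) hK
  have hcs := FDR.tendsto_cubeSize hd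
  obtain ⟨c₁, hc₁, c₂, hc₂, hb₁, hb₂⟩ := FDR.exists_pos_bounds_of_isTheta hbn
    (hb.mono fun n h => h.1.le) (fun n => by positivity)
  have hρ0 : Tendsto (fun n : ℕ => (n : ℝ) ^ (-(1 / 3) : ℝ)) atTop (𝓝 0) :=
    FDR.tendsto_natCast_rpow_neg (by norm_num)
  have hsmall : ∀ (L : ℝ) {x : ℝ}, 0 < x →
      ∀ᶠ N : Fin d → ℕ in atTop, L * (FDR.cubeSize N : ℝ) ^ (-(1 / 3) : ℝ) < x := fun L x hx => by
    have h := hρ0.const_mul L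
    rw [mul_zero] at h
    exact hcs.eventually (h.eventually_lt_const hx)
  have hexp : ∀ ε > 0, ∃ M₁ M₂ : ℝ, ∀ᶠ N : Fin d → ℕ in atTop, ∃ B : Set Ω, μ.real B ≤ ε ∧
      ∀ ω ∉ B,
        |(νPI N ω - νs) - (νs * (π₀ - πhat N ω) / (π₀ - α * FDR.mixDens π₀ g νs) +
          (FDR.empCdf X N ω νs - FDR.mixCdf π₀ G νs) / (π₀ / α - FDR.mixDens π₀ g νs))|
          ≤ M₁ * (FDR.cubeSize N : ℝ) ^ (-(2 / 3) : ℝ) ∧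
        |(FDR.fdProcess H X N ω (νPI N ω) - α) - α * (1 - πhat N ω / π₀)|
          ≤ M₂ * (FDR.cubeSize N : ℝ) ^ (-(1 / 2) : ℝ) := by
    intro ε hε
    obtain ⟨M, hM, hgood⟩ := FDR.exists_good_event hd hH hU hG hX hc₁ hb hb₁ hb₂ (half_pos hε)
    set L₁ := c' * c₂ + M / c₁ + M * K with hL₁
    have hL₁0 : 0 < L₁ := by positivity
    -- A radius `L * ρ` covers Storey's error `L₁ * ρ`, and the linear gap `κ * L * ρ` strictly
    -- exceeds the combined error of `F_n` and of the slope of the line.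
    set L := L₁ + (2 * M + L₁ / α + 1) / κ with hL
    have hL0 : 0 < L := by positivity
    have hL₁L : L₁ ≤ L := by rw [hL]; have : 0 < (2 * M + L₁ / α + 1) / κ := by positivity
                             linarith
    have hκL : 2 * M + L₁ / α < κ * L := by
      have : κ * ((2 * M + L₁ / α + 1) / κ) = 2 * M + L₁ / α + 1 := by field_simp
      rw [hL, mul_add, this]
      have : 0 < κ * L₁ := by positivity
      linarith
    obtain ⟨M', hM', hwin⟩ := FDR.exists_good_window hd hH hU hG hX hν0 hν1 hL0 (half_pos hε)
    refine ⟨(M' + M * K * L + c * L ^ 2 + L ^ 2 / α) / (π₀ / α - FDR.mixDens π₀ g νs),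
      8 * α * M / (νs * π₀) + 2 * α * L ^ 2 / π₀ ^ 2, ?_⟩
    filter_upwards [hgood, hwin, hcs.eventually_gt_atTop 0, hcs.eventually hb,
      hcs.eventually hb₁, hcs.eventually hb₂, hsmall c₂ hη₁, hsmall L hη, hsmall L hη',
      hsmall L (half_pos hν0), hsmall L (sub_pos.2 hν1), hsmall L (half_pos hπ₀)]
      with N hgood hwin hN hb hb₁ hb₂ s1 s2 s3 s4 s5 s6
    obtain ⟨hρ, hδ, hδρ, hρδ, -, hρ2, -⟩ := FDR.rpow_rates hN
    obtain ⟨B, hB, hgood⟩ := hgood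
    obtain ⟨B', hB', hwin⟩ := hwin
    refine ⟨B ∪ B', (measureReal_union_le _ _).trans (by linarith), fun ω hω => ?_⟩
    rw [Set.mem_union, not_or] at hω
    obtain ⟨he, hD, hDb, hD0⟩ := hgood ω hω.1
    have hwin := hwin ω hω.2
    rw [← hπ₀def] at he
    rw [hρ2] at hDb hwin hρδ
    rw [hρ2]
    set ρ := (FDR.cubeSize N : ℝ) ^ (-(1 / 3) : ℝ) with hρdef
    set δ := (FDR.cubeSize N : ℝ) ^ (-(1 / 2) : ℝ) with hδdef
    set e := FDR.falseNulls H N ω / FDR.cubeSize N - (1 - π₀) with hedef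
    set β := b (FDR.cubeSize N) with hβ
    have heρ : |e| ≤ M * ρ := he.trans (by gcongr)
    have hFn := FDR.empCdf_eq_mixCdf_add X N ω H G π₀
    have hp₁ : |πhat N ω - π₀| ≤ L₁ * ρ := by
      rw [hπhat, FDR.storey]
      have h1 := hquad₁ (1 - β) ⟨by linarith [hb.2], by linarith [hb.1]⟩
        (by rw [sub_sub_cancel_left, abs_neg, abs_of_pos hb.1]; linarith)
      -- Here `g 1 = 0` enters: the linear term of `1 - F (1 - β)` is then exactly `π₀ * β`, leaving
      -- a bias of order `β` after division.
      have h2 : FDR.mixDens π₀ g 1 = π₀ := by simp [FDR.mixDens, hg1]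
      rw [h2, hG.mixCdf_one, abs_sub_comm] at h1
      refine FDR.abs_storey_sub_le (Fb := FDR.mixCdf π₀ G (1 - β))
        (D := FDR.centredCdf H X G N ω (1 - β)) (e := e) (y := G (1 - β) - (1 - β)) hρ hb.1 hc'.le
        hc₁ hM.le hb₁ hb₂ ?_ hDb heρ ?_ (hFn (1 - β))
      · calc _ = |π₀ * (1 - β - 1) - (FDR.mixCdf π₀ G (1 - β) - 1)| := by congr 1; ring
          _ ≤ c' * (1 - β - 1) ^ 2 := h1
          _ = c' * β ^ 2 := by ring
      · have := hGdist (1 - β) 1 (by linarith [hb.2]) (by linarith [hb.1]) le_rfl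
        rw [hG.one, sub_self, zero_sub, abs_neg] at this
        simpa using this
    have hp : |πhat N ω - π₀| ≤ L * ρ := hp₁.trans (by gcongr)
    have hE : ∀ t ∈ Set.Icc (0 : ℝ) 1,
        |FDR.empCdf X N ω t - FDR.mixCdf π₀ G t| ≤ 2 * (M * ρ) := fun t ht =>
      FDR.abs_empCdf_sub_mixCdf_le X H G N ω (hGK.abs_sub_self_le ht) heρ
        ((hD t ht).trans (by gcongr))
    have hmono : MonotoneOn (FDR.empCdf X N ω) (Set.Icc 0 1) :=
      (FDR.monotone_empCdf X N ω).monotoneOn _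
    have hΦ0 := FDR.empCdf_nonneg X N ω 0
    have hνclose : |νPI N ω - νs| ≤ L * ρ := by
      rw [hνPI]
      refine FDR.abs_threshold_sub_le hα hν1.le hup hlow hmono hΦ0 hE hp₁ hκ ?_
        (by positivity) s3.le (by linarith)
      calc 2 * (M * ρ) + L₁ * ρ / α = (2 * M + L₁ / α) * ρ := by ring
        _ < κ * L * ρ := by gcongr
        _ = κ * (L * ρ) := by ring
    have hνb := abs_le.1 hνclose
    have hpb := abs_le.1 hp
    have mPI : νPI N ω ∈ Set.Icc (0 : ℝ) 1 := ⟨by linarith, by linarith⟩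
    -- Although `F_n` jumps, it meets the line exactly at the threshold, because it is
    -- right-continuous and the threshold is below `1`.
    have hFnν : FDR.empCdf X N ω (νPI N ω) = νPI N ω * πhat N ω / α := by
      have hlt : νPI N ω < 1 := by linarith
      rw [hνPI] at hlt ⊢
      exact FDR.apply_threshold hmono hΦ0 hlt
        ((FDR.continuousWithinAt_empCdf X N ω _).mono Set.Ioo_subset_Ioi_self)
    constructor
    · refine FDR.abs_threshold_expansion_le (K := K) (L := L) (M := M) (M' := M') (c := c) (ρ := ρ)
        (F' := FDR.mixCdf π₀ G (νPI N ω)) hα (sub_pos.2 hfν) hFν hFnν (hFn νs) (hFn (νPI N ω))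
        (hwin _ hνclose) (hquad _ mPI (by linarith)) ?_ heρ hνclose hp hc.le (by linarith) hM.le
        hρ.le hL0.le
      rcases le_total νs (νPI N ω) with h | h
      · rw [abs_of_nonneg (sub_nonneg.2 h)]
        exact hGdist _ _ mν.1 h mPI.2
      · rw [abs_sub_comm (νPI N ω), abs_of_nonneg (sub_nonneg.2 h), abs_sub_comm]
        exact hGdist _ _ mPI.1 h mν.2
    · have hpos : 0 < FDR.empCdf X N ω (νPI N ω) := by
        rw [hFnν]
        exact div_pos (mul_pos (by linarith) (by linarith)) hα
      rw [FDR.fdProcess_eq X H hN hpos, hFnν, FDR.empNull_eq_add X N ω H π₀]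
      exact FDR.abs_fdp_expansion_le (L := L) (ρ := ρ) hα hπ₀ hν0 (by linarith) mPI.2
        (by linarith) (hD0 _ mPI) he hp hρδ
  constructor
  · refine FDR.isBigOP_of_eventually fun ε hε => ?_
    obtain ⟨M₁, M₂, h⟩ := hexp ε hε
    exact ⟨M₁, h.mono fun N ⟨B, hB, hω⟩ => ⟨B, hB, fun ω h => (hω ω h).1⟩⟩
  · refine FDR.isBigOP_of_eventually fun ε hε => ?_
    obtain ⟨M₁, M₂, h⟩ := hexp ε hε
    exact ⟨M₂, h.mono fun N ⟨B, hB, hω⟩ => ⟨B, hB, fun ω h => (hω ω h).2⟩⟩
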